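/- **Setting.** Let $D=\{z\in\mathbb C:|z|<1\}$ and $C(z,w)=-\tfrac12 (z-w)^{-2}$. Let $\Upsilon$ be the free complex algebra spanned by the finite sequences $[z_1,\dots,z_n]$, $z_i\in\mathbb C$ (the empty one included), with juxtaposition as product. For distinct points put $\langle[z_1,\dots,z_n]\rangle=\sum_P\prod_{\{i,j\}\in P}C(z_i,z_j)$, the sum being over all pairings $P$ of $\{1,\dots,n\}$, and extend linearly. Let $\Theta$ be the antilinear map with $\Theta[z_1,\dots,z_n]=\prod_i(-\bar z_i^{-2})\,[1/\bar z_1,\dots,1/\bar z_n]$ for $z_i\ne0$. On the span $\Upsilon_{0,D-\{0\}}$ of the sequences of distinct points of $D\setminus\{0\}$ the form $(F,G)\mapsto\langle(\Theta F)G\rangle$ is Hermitian and positive semidefinite; $\mathcal H$ is the completion of the quotient of $\Upsilon_{0,D-\{0\}}$ by its null space, and $\nu_0:\Upsilon_{0,D-\{0\}}\to\mathcal H$ is the class map. For $m,l\ge1$ let $C(m,z;l,w)=\partial_z^{m-1}\partial_w^{l-1}C(z,w)=\tfrac12(-1)^m(m+l-1)!\,(z-w)^{-m-l}$. Let $\Upsilon^w$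 be the free complex algebra on the symbols $:\![m_1,z_1,\dots,m_n,z_n]\!:$ with $n\ge1$, $m_i\ge1$, $z_i\in\mathbb C$. Let $\Upsilon^w_{0,D}$ be the span of the products $:\!Z^1\!:\cdots:\!Z^r\!:$ ($r\ge0$) with all points in $D$, such that different factors have no point in common (points may coincide within one factor). The expectation of such a product is the sum, over the pairings of all the fields $(m,z)$ in it that pair no two fields of the same factor, of the products of the $C(m,z;l,w)$ over the pairs. Identify $[z_1,\dots,z_n]$ with $:\![1,z_1]\!:\cdots:\![1,z_n]\!:$, and abbreviate $:\![1,z]\!:$ as $[1,z]$. **Theorem.** 1. There is a unique linear map $\nu:\Upsilon^w_{0,D}\to\mathcal H$ with $(\nu_0(G),\nu(F))=\langle(\Theta G)F\rangle$ for all $G\in\Upsilon_{0,D-\{0\}}$ and $F\in\Upsilon^w_{0,D}$, and it extends $\nu_0$. Put $\Omega=\nu(\emptyset)$ and $\mathcal D=\nu(\Upsilon^w_{0,D})$. 2. There is a unique family of linear operators $\alpha_m:\mathcal D\to\mathcal D$, $m\in\mathbb Z$, with $$\alpha_m\,\nu(F)=\sqrt2\oint_{|z|=r}\frac{dz}{2\pi}\,z^m\,\nu([1,z]F)$$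 for all $F\in\Upsilon^w_{0,D}$ and all $0<r<1$ such that all points in $F$ have modulus less than $r$. 3. For all $n\ge1$ and $m_1,\dots,m_n\ge1$, $$\alpha_{-m_1}\cdots\alpha_{-m_n}\Omega=\prod_{j=1}^n\frac{\sqrt2\,i}{(m_j-1)!}\;\nu\big(:\![m_1,0,\dots,m_n,0]\!:\big).$$ 4. The vectors $\alpha_{-m_1}\cdots\alpha_{-m_n}\Omega$ ($n\ge0$, $m_i\ge1$) span a dense subspace of $\mathcal H$. 5. Hence $\mathcal H$ is separable and naturally isomorphic to bosonic Fock space. That is, let $\mathcal F=\ell^2(\mathcal N)$, where $\mathcal N$ is the set of finitely supported functions $n:\{1,2,\dots\}\to\mathbb Z_{\ge0}$ (occupation number representation). There is a unitary $U:\mathcal H\to\mathcal F$ such that $U\Omega=\delta_0$ and, for all $v\in\mathcal D$, $m\ge1$ and $n\in\mathcal N$, with $e_m$ the indicator function of $\{m\}$, $$(U\alpha_mv)(n)=\sqrt{m(n_m+1)}\;(Uv)(n+e_m),\qquad (U\alpha_{-m}v)(n)=\begin{cases}\sqrt{m\,n_m}\;(Uv)(n-e_m)&\text{if }n_m\ge1,\\0&\text{if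 }n_m=0.\end{cases}$$ -/

import Mathlib

open scoped ComplexConjugate Nat

noncomputable section

namespace Boson

/-! ### Pairings -/

/-- All ways of picking one entry of a list: the list of pairs (entry, remaining list). -/
def picks {β : Type*} : List β → List (β × List β)
  | [] => []
  | a :: L => (a, L) :: (picks L).map fun p => (p.1, a :: p.2)

theorem length_of_mem_picks {β : Type*} : ∀ {L : List β} {p : β × List β}, p ∈ picks L →
    p.2.length + 1 = L.length
  | [], p, h => by simp [picks] at h
  | a :: L, p, h => by
      simp only [picks, List.mem_cons, List.mem_map] at h
      rcases h with rfl | ⟨q, hq, rfl⟩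
      · rfl
      · simpa using length_of_mem_picks hq

/-- All pairings (perfect matchings) of the entries of a list, each listed exactly once: the first
entry is paired with one of the later entries, and the remaining entries are paired. -/
def pairings {β : Type*} : List β → List (List (β × β))
  | [] => [[]]
  | a :: L => (picks L).attach.flatMap fun p => (pairings p.1.2).map fun P => (a, p.1.1) :: P
termination_by L => L.length
decreasing_by
  have := length_of_mem_picks p.2
  simp only [List.length_cons]; omega

/-- The sum over all pairings `P` of the product of `c a b` over the pairs `{a, b}` in `P`. -/
def pairingSum {β : Type*} (c : β → β → ℂ) (L : List β) : ℂ :=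
  ((pairings L).map fun P => (P.map fun p => c p.1 p.2).prod).sum

theorem sum_map_attach {β A : Type*} [AddCommMonoid A] (l : List β) (f : β → A) :
    (l.attach.map fun p => f p.1).sum = (l.map f).sum := by
  conv_rhs => rw [← List.attach_map_subtype_val l, List.map_map]
  rfl

theorem pairingSum_nil {β : Type*} (c : β → β → ℂ) : pairingSum c [] = 1 := by
  simp [pairingSum, pairings]

theorem pairingSum_cons {β : Type*} (c : β → β → ℂ) (a : β) (L : List β) :
    pairingSum c (a :: L) = ((picks L).map fun p => c a p.1 * pairingSum c p.2).sum := by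
  rw [pairingSum, pairings]
  have h : ∀ l : List {p // p ∈ picks L}, ((l.flatMap fun p => (pairings p.1.2).map
      fun P => (a, p.1.1) :: P).map fun P => (P.map fun p => c p.1 p.2).prod).sum =
      (l.map fun p => c a p.1.1 * pairingSum c p.1.2).sum := by
    intro l
    induction l with
    | nil => simp
    | cons p l ih =>
      rw [List.flatMap_cons, List.map_append, List.sum_append, ih, List.map_cons, List.sum_cons,
        List.map_map, pairingSum, ← List.sum_map_mul_left]
      rfl
  rw [h, sum_map_attach (picks L) fun p => c a p.1 * pairingSum c p.2]

theorem picks_map {β γ : Type*} (g : β → γ) : ∀ L : List β,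
    picks (L.map g) = (picks L).map fun p => (g p.1, p.2.map g)
  | [] => rfl
  | a :: L => by simp [picks, picks_map g L, Function.comp_def]

theorem picks_append {β : Type*} : ∀ L M : List β,
    picks (L ++ M) = ((picks L).map fun p => (p.1, p.2 ++ M)) ++
      (picks M).map fun p => (p.1, L ++ p.2)
  | [], M => by simp [picks]
  | a :: L, M => by simp [picks, picks_append L M, Function.comp_def]

theorem picks_swap {β A : Type*} [AddCommMonoid A] (L : List β) : ∀ (f : β → β → List β → A),
    ((picks L).map fun p => ((picks p.2).map fun q => f p.1 q.1 q.2).sum).sum =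
      ((picks L).map fun p => ((picks p.2).map fun q => f q.1 p.1 q.2).sum).sum := by
  induction L with
  | nil => intro f; simp [picks]
  | cons a L ih =>
    intro f
    have h := ih fun b c M => f b c (a :: M)
    simp only [picks, List.map_cons, List.sum_cons, List.map_map, Function.comp_def,
      List.sum_map_add] at h ⊢
    rw [h]
    abel

theorem prod_picks {β : Type*} (f : β → ℂ) : ∀ {L : List β} {p : β × List β}, p ∈ picks L →
    (L.map f).prod = f p.1 * (p.2.map f).prod
  | [], p, h => by simp [picks] at h
  | a :: L, p, h => by
      simp only [picks, List.mem_cons, List.mem_map] at h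
      rcases h with rfl | ⟨q, hq, rfl⟩
      · simp
      · simp only [List.map_cons, List.prod_cons, prod_picks f hq]; ring

theorem mem_of_mem_picks {β : Type*} : ∀ {L : List β} {p : β × List β}, p ∈ picks L →
    p.1 ∈ L ∧ ∀ b ∈ p.2, b ∈ L
  | [], p, h => by simp [picks] at h
  | a :: L, p, h => by
      simp only [picks, List.mem_cons, List.mem_map] at h
      rcases h with rfl | ⟨q, hq, rfl⟩
      · simp +contextual
      · have := mem_of_mem_picks hq
        simp only [List.mem_cons]
        grind

theorem pairingSum_congr_picks {β γ : Type*} (c : β → β → ℂ) (d : γ → γ → ℂ) (g : β → γ)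
    (f : β → ℂ) (n : ℕ) : ∀ L : List β, L.length = n →
    (∀ a ∈ L, ∀ b ∈ L, d (g a) (g b) * (f a * f b) = c a b) →
    (L.map f).prod * pairingSum d (L.map g) = pairingSum c L := by
  induction n using Nat.strong_induction_on with
  | _ n ih =>
  intro L hn h
  cases L with
  | nil => simp [pairingSum_nil]
  | cons a L =>
    rw [List.map_cons, List.map_cons, pairingSum_cons, pairingSum_cons, picks_map, List.map_map,
      ← List.sum_map_mul_left]
    congr 1
    refine List.map_congr_left fun p hp => ?_
    have hl := length_of_mem_picks hp
    have hm := mem_of_mem_picks hp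
    have := ih p.2.length (by simp at hn; omega) p.2 rfl fun b hb b' hb' =>
      h b (List.mem_cons_of_mem _ (hm.2 b hb)) b' (List.mem_cons_of_mem _ (hm.2 b' hb'))
    rw [← this, ← h a (by simp) p.1 (List.mem_cons_of_mem _ hm.1), List.prod_cons,
      prod_picks f hp]
    simp only [Function.comp]
    ring

theorem tendsto_pairingSum {β : Type*} (c : ℕ → β → β → ℂ) (d : β → β → ℂ) (n : ℕ) :
    ∀ L : List β, L.length = n →
    (∀ a ∈ L, ∀ b ∈ L, Filter.Tendsto (fun N => c N a b) Filter.atTop (nhds (d a b))) →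
    Filter.Tendsto (fun N => pairingSum (c N) L) Filter.atTop (nhds (pairingSum d L)) := by
  induction n using Nat.strong_induction_on with
  | _ n ih =>
  intro L hn h
  cases L with
  | nil => simp [pairingSum_nil]
  | cons a L =>
    simp only [pairingSum_cons]
    refine tendsto_list_sum _ fun p hp => ?_
    have hl := length_of_mem_picks hp
    have hm := mem_of_mem_picks hp
    exact (h a (by simp) p.1 (List.mem_cons_of_mem _ hm.1)).mul
      (ih p.2.length (by simp at hn; omega) p.2 rfl fun b hb b' hb' =>
        h b (List.mem_cons_of_mem _ (hm.2 b hb)) b' (List.mem_cons_of_mem _ (hm.2 b' hb')))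

/-! ### A polynomial model -/

/-- The vector of a product of fields in a polynomial model of finitely many modes. -/
def wickPoly {β : Type*} (c : β → β → ℂ) (e : β → MvPolynomial ℕ ℂ) :
    List β → MvPolynomial ℕ ℂ
  | [] => 1
  | a :: L => e a * wickPoly c e L +
      ((picks L).attach.map fun p => MvPolynomial.C (c a p.1.1) * wickPoly c e p.1.2).sum
termination_by L => L.length
decreasing_by
  · simp
  · have := length_of_mem_picks p.2
    simp only [List.length_cons]; omega

theorem wickPoly_cons {β : Type*} (c : β → β → ℂ) (e : β → MvPolynomial ℕ ℂ) (a : β)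
    (L : List β) : wickPoly c e (a :: L) = e a * wickPoly c e L +
      ((picks L).map fun p => MvPolynomial.C (c a p.1) * wickPoly c e p.2).sum := by
  rw [wickPoly]
  rw [sum_map_attach (picks L) fun p => MvPolynomial.C (c a p.1) * wickPoly c e p.2]

theorem pderiv_list_sum {ι : Type*} (k : ℕ) (f : ι → MvPolynomial ℕ ℂ) (l : List ι) :
    MvPolynomial.pderiv k (l.map f).sum = (l.map fun i => MvPolynomial.pderiv k (f i)).sum := by
  rw [map_list_sum, List.map_map]; rfl

theorem pderiv_wickPoly {β : Type*} (c : β → β → ℂ) (e : β → MvPolynomial ℕ ℂ) (k : ℕ)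
    (s : β → ℂ) (he : ∀ a, MvPolynomial.pderiv k (e a) = MvPolynomial.C (s a)) (n : ℕ) :
    ∀ L : List β, L.length = n → MvPolynomial.pderiv k (wickPoly c e L) =
      ((picks L).map fun p => MvPolynomial.C (s p.1) * wickPoly c e p.2).sum := by
  induction n using Nat.strong_induction_on with
  | _ n ih =>
  intro L hn
  cases L with
  | nil => simp [wickPoly, picks]
  | cons a L =>
    have ihL := ih L.length (by simp at hn; omega) L rfl
    rw [wickPoly_cons, map_add, MvPolynomial.pderiv_mul, he, ihL, pderiv_list_sum]
    have h1 : ((picks L).map fun p => MvPolynomial.pderiv k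
          (MvPolynomial.C (c a p.1) * wickPoly c e p.2)) =
        (picks L).map fun p => ((picks p.2).map fun q =>
          MvPolynomial.C (c a p.1) * (MvPolynomial.C (s q.1) * wickPoly c e q.2)).sum := by
      refine List.map_congr_left fun p hp => ?_
      have hl := length_of_mem_picks hp
      rw [MvPolynomial.pderiv_mul, MvPolynomial.pderiv_C, zero_mul, zero_add,
        ih p.2.length (by simp at hn; omega) p.2 rfl, List.sum_map_mul_left]
    rw [h1, picks_swap L fun b b' M =>
      MvPolynomial.C (c a b) * (MvPolynomial.C (s b') * wickPoly c e M)]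
    simp only [picks, List.map_cons, List.sum_cons, List.map_map, Function.comp_def,
      wickPoly_cons, mul_add, List.sum_map_add, ← List.sum_map_mul_left]
    rw [add_assoc]
    congr 3
    · refine List.map_congr_left fun p _ => mul_left_comm _ _ _
    · refine List.map_congr_left fun p _ => ?_
      congr 1
      refine List.map_congr_left fun q _ => mul_left_comm _ _ _

/-- The inner product on polynomials for which monomials are orthogonal, with norm squared equal
to the product of the factorials of the exponents. -/
def polyForm (P Q : MvPolynomial ℕ ℂ) : ℂ :=
  ∑ n ∈ P.support, conj (MvPolynomial.coeff n P) *
    (MvPolynomial.coeff n Q * ((n.prod fun _ k => k ! : ℕ) : ℂ))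

theorem polyForm_eq {P Q : MvPolynomial ℕ ℂ} {S : Finset (ℕ →₀ ℕ)} (h : P.support ⊆ S) :
    polyForm P Q = ∑ n ∈ S, conj (MvPolynomial.coeff n P) *
      (MvPolynomial.coeff n Q * ((n.prod fun _ k => k ! : ℕ) : ℂ)) := by
  refine Finset.sum_subset h fun n _ hn => ?_
  rw [MvPolynomial.notMem_support_iff.1 hn]; simp

theorem polyForm_add_left (P P' Q : MvPolynomial ℕ ℂ) :
    polyForm (P + P') Q = polyForm P Q + polyForm P' Q := by
  classical
  rw [polyForm_eq (MvPolynomial.support_add (p := P) (q := P')),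
    polyForm_eq (P := P) Finset.subset_union_left, polyForm_eq (P := P') Finset.subset_union_right,
    ← Finset.sum_add_distrib]
  refine Finset.sum_congr rfl fun n _ => ?_
  rw [MvPolynomial.coeff_add, map_add]; ring

theorem polyForm_add_right (P Q Q' : MvPolynomial ℕ ℂ) :
    polyForm P (Q + Q') = polyForm P Q + polyForm P Q' := by
  simp only [polyForm, MvPolynomial.coeff_add, ← Finset.sum_add_distrib]
  exact Finset.sum_congr rfl fun n _ => by ring

theorem polyForm_C_mul_left (a : ℂ) (P Q : MvPolynomial ℕ ℂ) :
    polyForm (MvPolynomial.C a * P) Q = conj a * polyForm P Q := by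
  have h : (MvPolynomial.C a * P).support ⊆ P.support := by
    intro n hn
    rw [MvPolynomial.mem_support_iff, MvPolynomial.coeff_C_mul] at hn
    exact MvPolynomial.mem_support_iff.2 (right_ne_zero_of_mul hn)
  rw [polyForm_eq h, polyForm, Finset.mul_sum]
  refine Finset.sum_congr rfl fun n _ => ?_
  rw [MvPolynomial.coeff_C_mul, map_mul]; ring

theorem polyForm_C_mul_right (a : ℂ) (P Q : MvPolynomial ℕ ℂ) :
    polyForm P (MvPolynomial.C a * Q) = a * polyForm P Q := by
  simp only [polyForm, MvPolynomial.coeff_C_mul, Finset.mul_sum]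
  exact Finset.sum_congr rfl fun n _ => by ring

theorem polyForm_list_sum_right {ι : Type*} (P : MvPolynomial ℕ ℂ) (f : ι → MvPolynomial ℕ ℂ)
    (l : List ι) : polyForm P (l.map f).sum = (l.map fun i => polyForm P (f i)).sum := by
  induction l with
  | nil => simp [polyForm]
  | cons a l ih => simp [polyForm_add_right, ih]

theorem polyForm_list_sum_left {ι : Type*} (Q : MvPolynomial ℕ ℂ) (f : ι → MvPolynomial ℕ ℂ)
    (l : List ι) : polyForm (l.map f).sum Q = (l.map fun i => polyForm (f i) Q).sum := by
  induction l with
  | nil => simp [polyForm]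
  | cons a l ih => simp [polyForm_add_left, ih]

theorem polyForm_one_left (Q : MvPolynomial ℕ ℂ) : polyForm 1 Q = MvPolynomial.coeff 0 Q := by
  classical
  have h : (1 : MvPolynomial ℕ ℂ).support ⊆ {0} := by
    rw [MvPolynomial.support_one]
  rw [polyForm_eq h]; simp

theorem polyForm_monomial_left (n : ℕ →₀ ℕ) (a : ℂ) (Q : MvPolynomial ℕ ℂ) :
    polyForm (MvPolynomial.monomial n a) Q =
      conj a * (MvPolynomial.coeff n Q * ((n.prod fun _ k => k ! : ℕ) : ℂ)) := by
  classical
  rw [polyForm_eq MvPolynomial.support_monomial_subset]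
  simp

theorem prod_factorial_add_single (n : ℕ →₀ ℕ) (k : ℕ) :
    ((n + Finsupp.single k 1).prod fun _ j => j !) = (n k + 1) * n.prod fun _ j => j ! := by
  classical
  have h1 := Finsupp.mul_prod_erase' n k (fun _ j => j !) (by simp)
  have h2 := Finsupp.mul_prod_erase' (n + Finsupp.single k 1) k (fun _ j => j !) (by simp)
  rw [← h1, ← h2, Finsupp.erase_add, Finsupp.erase_single, add_zero]
  simp [Nat.factorial_succ, mul_assoc]

theorem polyForm_X_mul (k : ℕ) (P Q : MvPolynomial ℕ ℂ) :
    polyForm (MvPolynomial.X k * P) Q = polyForm P (MvPolynomial.pderiv k Q) := by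
  induction P using MvPolynomial.induction_on' with
  | add p q hp hq => rw [mul_add, polyForm_add_left, polyForm_add_left, hp, hq]
  | monomial n a =>
    rw [mul_comm, MvPolynomial.X, MvPolynomial.monomial_mul, polyForm_monomial_left,
      polyForm_monomial_left, MvPolynomial.coeff_pderiv, prod_factorial_add_single]
    push_cast
    ring_nf

theorem polyForm_conj (P Q : MvPolynomial ℕ ℂ) : conj (polyForm Q P) = polyForm P Q := by
  classical
  rw [polyForm_eq (Finset.subset_union_left (s₂ := P.support)),
    polyForm_eq (P := P) (Finset.subset_union_right (s₁ := Q.support)), map_sum]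
  refine Finset.sum_congr rfl fun n _ => ?_
  simp only [map_mul, Complex.conj_conj, map_natCast]
  ring

theorem polyForm_self_nonneg (P : MvPolynomial ℕ ℂ) : 0 ≤ (polyForm P P).re := by
  rw [polyForm, Complex.re_sum]
  refine Finset.sum_nonneg fun n _ => ?_
  rw [← mul_assoc, ← Complex.normSq_eq_conj_mul_self, ← Complex.ofReal_natCast,
    ← Complex.ofReal_mul, Complex.ofReal_re]
  exact mul_nonneg (Complex.normSq_nonneg _) (Nat.cast_nonneg _)

theorem coeff_zero_wickPoly {β : Type*} (c : β → β → ℂ) (e : β → MvPolynomial ℕ ℂ)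
    (he : ∀ a, MvPolynomial.coeff 0 (e a) = 0) (n : ℕ) :
    ∀ L : List β, L.length = n → MvPolynomial.coeff 0 (wickPoly c e L) = pairingSum c L := by
  induction n using Nat.strong_induction_on with
  | _ n ih =>
  intro L hn
  cases L with
  | nil => simp [wickPoly, pairingSum_nil]
  | cons a L =>
    have he' : MvPolynomial.constantCoeff (e a) = 0 := he a
    rw [wickPoly_cons, pairingSum_cons, ← MvPolynomial.constantCoeff_eq, map_add, map_mul,
      he', zero_mul, zero_add, map_list_sum, List.map_map]
    congr 1
    refine List.map_congr_left fun p hp => ?_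
    have hl := length_of_mem_picks hp
    simp only [Function.comp, map_mul, MvPolynomial.constantCoeff_C]
    rw [MvPolynomial.constantCoeff_eq, ih p.2.length (by simp at hn; omega) p.2 rfl]

/-- The weights of the pairings of a reflected family with an unreflected one. -/
def crossWeight {β : Type*} (c K : β → β → ℂ) : β ⊕ β → β ⊕ β → ℂ
  | .inl a, .inl b => conj (c a b)
  | .inl a, .inr b => K a b
  | .inr a, .inl b => K b a
  | .inr a, .inr b => c a b

theorem polyForm_wickPoly {β : Type*} (c : β → β → ℂ) (s : ℕ → β → ℂ) (N n : ℕ) :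
    ∀ Z W : List β, Z.length = n →
    polyForm (wickPoly c (fun a => ∑ k ∈ Finset.range N, MvPolynomial.C (s k a) *
        MvPolynomial.X k) Z)
      (wickPoly c (fun a => ∑ k ∈ Finset.range N, MvPolynomial.C (s k a) *
        MvPolynomial.X k) W) =
    pairingSum (crossWeight c fun a b => ∑ k ∈ Finset.range N, conj (s k a) * s k b)
      (Z.map Sum.inl ++ W.map Sum.inr) := by
  set e : β → MvPolynomial ℕ ℂ := fun a => ∑ k ∈ Finset.range N, MvPolynomial.C (s k a) *
    MvPolynomial.X k with he
  set K : β → β → ℂ := fun a b => ∑ k ∈ Finset.range N, conj (s k a) * s k b with hK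
  have he0 : ∀ a, MvPolynomial.coeff 0 (e a) = 0 := fun a => by
    simp [he, MvPolynomial.coeff_sum, MvPolynomial.coeff_C_mul]
  have hd : ∀ k ∈ Finset.range N, ∀ a, MvPolynomial.pderiv k (e a) = MvPolynomial.C (s k a) := by
    intro k hk a
    classical
    simp only [he, map_sum, MvPolynomial.pderiv_C_mul, MvPolynomial.pderiv_X, Pi.single_apply]
    rw [Finset.sum_eq_single k]
    · simp
    · intro b _ hb; simp [hb]
    · exact fun h => absurd hk h
  induction n using Nat.strong_induction_on with
  | _ n ih =>
  intro Z W hn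
  cases Z with
  | nil =>
    rw [wickPoly, polyForm_one_left, coeff_zero_wickPoly c e he0 _ W rfl, List.map_nil,
      List.nil_append]
    have := pairingSum_congr_picks c (crossWeight c K) Sum.inr (fun _ => 1) _ W rfl
      (fun a _ b _ => by simp [crossWeight])
    simpa using this.symm
  | cons z Z =>
    rw [wickPoly_cons, polyForm_add_left, polyForm_list_sum_left, List.map_cons, List.cons_append,
      pairingSum_cons, picks_append, picks_map, picks_map, List.map_append, List.sum_append,
      add_comm]
    congr 1
    · rw [List.map_map, List.map_map]
      congr 1
      refine List.map_congr_left fun p hp => ?_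
      have hl := length_of_mem_picks hp
      rw [polyForm_C_mul_left, ih p.2.length (by simp at hn; omega) p.2 W rfl]
      rfl
    · have h1 : polyForm (e z * wickPoly c e Z) (wickPoly c e W) =
          ∑ k ∈ Finset.range N, ((picks W).map fun p => conj (s k z) * (s k p.1 *
            polyForm (wickPoly c e Z) (wickPoly c e p.2))).sum := by
        have hs : ∀ S : Finset ℕ, S ⊆ Finset.range N →
            polyForm ((∑ k ∈ S, MvPolynomial.C (s k z) * MvPolynomial.X k) * wickPoly c e Z)
              (wickPoly c e W) = ∑ k ∈ S, ((picks W).map fun p => conj (s k z) * (s k p.1 *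
            polyForm (wickPoly c e Z) (wickPoly c e p.2))).sum := by
          intro S
          induction S using Finset.induction_on with
          | empty => intro _; simp [polyForm]
          | insert k S hk ihS =>
            intro hS
            rw [Finset.sum_insert hk, Finset.sum_insert hk, add_mul, polyForm_add_left,
              ihS fun x hx => hS (Finset.mem_insert_of_mem hx), mul_assoc, polyForm_C_mul_left,
              polyForm_X_mul, pderiv_wickPoly c e k (s k)
                (hd k (hS (Finset.mem_insert_self k S))) _ W rfl, polyForm_list_sum_right,
              ← List.sum_map_mul_left]
            simp only [polyForm_C_mul_right]
        exact hs _ (Finset.Subset.refl _)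
      have h2 : ∀ l : List (β × List β), ∑ k ∈ Finset.range N, (l.map fun p => conj (s k z) *
          (s k p.1 * polyForm (wickPoly c e Z) (wickPoly c e p.2))).sum =
          (l.map fun p => K z p.1 * polyForm (wickPoly c e Z) (wickPoly c e p.2)).sum := by
        intro l
        induction l with
        | nil => simp
        | cons p l ihl =>
          simp only [List.map_cons, List.sum_cons, Finset.sum_add_distrib, ihl, hK,
            Finset.sum_mul, mul_assoc]
      rw [h1, h2, List.map_map, List.map_map]
      congr 1
      refine List.map_congr_left fun p hp => ?_
      rw [ih Z.length (by simp at hn; omega) Z p.2 rfl]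
      rfl

/-! ### The algebra of fields -/

/-- The two-point function `⟨∂X(z) ∂X(w)⟩`. -/
def twoPoint (z w : ℂ) : ℂ := -(1 / 2) * (1 / (z - w) ^ 2)

/-- The free algebra on `ℂ`: formal linear combinations of the finite sequences `[z₁, …, zₙ]`
(the empty one included), multiplied by juxtaposition. -/
abbrev FieldAlg : Type := MonoidAlgebra ℂ (FreeMonoid ℂ)

/-- The expectation, linear with `⟨[z₁, …, zₙ]⟩ = ∑_P ∏_{{i, j} ∈ P} ⟨∂X(zᵢ) ∂X(zⱼ)⟩`, the sum
being over all pairings. (Used only on sequences without coinciding points.) -/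
def expect : FieldAlg →ₗ[ℂ] ℂ :=
  (Finsupp.linearCombination ℂ fun Z : FreeMonoid ℂ => pairingSum twoPoint Z.toList) ∘ₗ
    (MonoidAlgebra.coeffLinearEquiv ℂ).toLinearMap

/-- The antilinear reflection through the unit circle,
`Θ [z₁, …, zₙ] = ∏ (-1 / z̄ᵢ²) [1 / z̄₁, …, 1 / z̄ₙ]`. -/
def reflect (F : FieldAlg) : FieldAlg :=
  F.coeff.sum fun Z a => (conj a * (Z.toList.map fun z => -1 / conj z ^ 2).prod) •
    MonoidAlgebra.single (FreeMonoid.map (fun z => 1 / conj z) Z) 1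

/-- Sequences of distinct points of the punctured unit disc. -/
def discSymbols : Set (FreeMonoid ℂ) :=
  {Z | Z.toList.Nodup ∧ ∀ z ∈ Z.toList, z ≠ 0 ∧ ‖z‖ < 1}

/-- The span of the sequences of distinct points of the punctured unit disc. -/
def DiscFields : Type := ↥(MonoidAlgebra.supported ℂ ℂ discSymbols)

namespace DiscFields

instance : AddCommGroup DiscFields :=
  inferInstanceAs (AddCommGroup ↥(MonoidAlgebra.supported ℂ ℂ discSymbols))

instance : Module ℂ DiscFields :=
  inferInstanceAs (Module ℂ ↥(MonoidAlgebra.supported ℂ ℂ discSymbols))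

/-- The inclusion into the algebra of all fields. -/
def incl : DiscFields →ₗ[ℂ] FieldAlg := (MonoidAlgebra.supported ℂ ℂ discSymbols).subtype

end DiscFields

theorem reflect_add (F G : FieldAlg) : reflect (F + G) = reflect F + reflect G := by
  rw [reflect, MonoidAlgebra.coeff_add, Finsupp.sum_add_index']
  · rfl
  · simp
  · intro Z a b; rw [map_add, add_mul, add_smul]

theorem reflect_smul (r : ℂ) (F : FieldAlg) : reflect (r • F) = conj r • reflect F := by
  rw [reflect, MonoidAlgebra.coeff_smul, Finsupp.sum_smul_index (by simp), reflect,
    Finsupp.smul_sum]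
  simp only [map_mul, mul_assoc, smul_smul]

theorem twoPoint_comm (z w : ℂ) : twoPoint z w = twoPoint w z := by
  rw [twoPoint, twoPoint, ← neg_sub, neg_sq]

theorem twoPoint_reflect {z w : ℂ} (hz : z ≠ 0) (hw : w ≠ 0) :
    twoPoint (1 / conj z) (1 / conj w) =
      conj z ^ 2 * conj w ^ 2 * conj (twoPoint z w) := by
  have hz' : conj z ≠ 0 := by simpa using hz
  have hw' : conj w ≠ 0 := by simpa using hw
  have h : 1 / conj z - 1 / conj w = (conj w - conj z) / (conj z * conj w) := by field_simp
  rw [twoPoint_comm z w, twoPoint, twoPoint, h]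
  rw [div_pow, one_div_div, mul_pow, map_mul, map_neg, map_div₀, map_div₀, map_one,
    map_ofNat, map_pow, map_sub]
  ring

/-- The value of `⟨(Θ Z) W⟩` on sequences. -/
def symbolForm (Z W : FreeMonoid ℂ) : ℂ :=
  (Z.toList.map fun z => -1 / conj z ^ 2).prod *
    pairingSum twoPoint (Z.toList.map (fun z => 1 / conj z) ++ W.toList)

theorem expect_reflect_mul (F G : FieldAlg) : expect (reflect F * G) =
    ∑ Z ∈ F.coeff.support, ∑ W ∈ G.coeff.support,
      conj (F.coeff Z) * (G.coeff W * symbolForm Z W) := by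
  have hG : G = ∑ W ∈ G.coeff.support, G.coeff W • MonoidAlgebra.single W 1 := by
    conv_lhs => rw [← G.sum_coeff_single, Finsupp.sum]
    simp [MonoidAlgebra.smul_single]
  conv_lhs => rw [hG]
  rw [reflect, Finsupp.sum, Finset.sum_mul, map_sum]
  refine Finset.sum_congr rfl fun Z _ => ?_
  rw [Finset.mul_sum, map_sum]
  refine Finset.sum_congr rfl fun W _ => ?_
  rw [smul_mul_smul_comm, MonoidAlgebra.single_mul_single, map_smul]
  simp [expect, symbolForm, FreeMonoid.toList_map]
  ring

/-- The expansion coefficients of the reflected two-point function. -/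
def modeCoeff (k : ℕ) (z : ℂ) : ℂ := ((√((k + 1) / 2) : ℝ) : ℂ) * z ^ k

theorem tendsto_modeCoeff {z w : ℂ} (hz : z ≠ 0) (hz1 : ‖z‖ < 1) (hw1 : ‖w‖ < 1) :
    Filter.Tendsto (fun N => ∑ k ∈ Finset.range N, conj (modeCoeff k z) * modeCoeff k w)
      Filter.atTop (nhds (-1 / conj z ^ 2 * twoPoint (1 / conj z) w)) := by
  have hn : ‖conj z * w‖ < 1 := by
    rw [norm_mul, Complex.norm_conj]
    exact mul_lt_one_of_nonneg_of_lt_one_left (norm_nonneg _) hz1 hw1.le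
  have h := ((hasSum_choose_mul_geometric_of_norm_lt_one 1 hn).mul_left (1 / 2)).tendsto_sum_nat
  have hcz : conj z ≠ 0 := by simpa using hz
  have h1 : 1 - conj z * w ≠ 0 := by
    intro h0
    rw [← sub_eq_zero.1 h0] at hn
    simp at hn
  have h2 : 1 / conj z - w ≠ 0 := by
    intro h0
    apply h1
    rw [← sub_eq_zero.1 h0]
    field_simp
    simp
  convert h using 1
  · funext N
    refine Finset.sum_congr rfl fun k _ => ?_
    have hs : ((√((k + 1) / 2) : ℝ) : ℂ) * ((√((k + 1) / 2) : ℝ) : ℂ) = (k + 1) / 2 := by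
      rw [← Complex.ofReal_mul, Real.mul_self_sqrt (by positivity)]
      push_cast; ring
    simp only [modeCoeff, map_mul, map_pow, Complex.conj_ofReal, Nat.choose_one_right, mul_pow]
    push_cast
    linear_combination (conj z ^ k * w ^ k) * hs
  · have h3 : 1 / conj z - w = (1 - conj z * w) / conj z := by field_simp
    congr 1
    rw [twoPoint, h3]
    field_simp

theorem tendsto_symbolForm {Z W : FreeMonoid ℂ} (hZ : Z ∈ discSymbols) (hW : W ∈ discSymbols) :
    Filter.Tendsto (fun N => polyForm
      (wickPoly twoPoint (fun a => ∑ k ∈ Finset.range N, MvPolynomial.C (modeCoeff k a) *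
        MvPolynomial.X k) Z.toList)
      (wickPoly twoPoint (fun a => ∑ k ∈ Finset.range N, MvPolynomial.C (modeCoeff k a) *
        MvPolynomial.X k) W.toList)) Filter.atTop (nhds (symbolForm Z W)) := by
  simp only [polyForm_wickPoly twoPoint modeCoeff _ _ Z.toList W.toList rfl]
  have hmem : ∀ a ∈ (Z.toList.map Sum.inl ++ W.toList.map Sum.inr : List (ℂ ⊕ ℂ)),
      Sum.elim (fun z : ℂ => z ≠ 0 ∧ ‖z‖ < 1) (fun w : ℂ => ‖w‖ < 1) a := by
    intro a ha
    simp only [List.mem_append, List.mem_map] at ha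
    rcases ha with ⟨z, hz, rfl⟩ | ⟨w, hw, rfl⟩
    · exact hZ.2 z hz
    · exact (hW.2 w hw).2
  have h := pairingSum_congr_picks
    (crossWeight twoPoint fun z w => -1 / conj z ^ 2 * twoPoint (1 / conj z) w) twoPoint
    (Sum.elim (fun z => 1 / conj z) id) (Sum.elim (fun z => -1 / conj z ^ 2) fun _ => 1) _
    (Z.toList.map Sum.inl ++ W.toList.map Sum.inr) rfl (by
      intro a ha b hb
      have ha' := hmem a ha
      have hb' := hmem b hb
      rcases a with z | z <;> rcases b with w | w <;>
        simp only [Sum.elim_inl, Sum.elim_inr, crossWeight, id] at ha' hb' ⊢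
      · have hz' : conj z ≠ 0 := by simpa using ha'.1
        have hw' : conj w ≠ 0 := by simpa using hb'.1
        rw [twoPoint_reflect ha'.1 hb'.1]
        field_simp
      · ring
      · rw [twoPoint_comm]; ring
      · ring)
  have h' : symbolForm Z W = pairingSum
      (crossWeight twoPoint fun z w => -1 / conj z ^ 2 * twoPoint (1 / conj z) w)
      (Z.toList.map Sum.inl ++ W.toList.map Sum.inr) := by
    rw [← h, symbolForm]
    simp [Function.comp_def]
  rw [h']
  refine tendsto_pairingSum _ _ _ _ rfl fun a ha b hb => ?_
  have ha' := hmem a ha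
  have hb' := hmem b hb
  rcases a with z | z <;> rcases b with w | w <;>
    simp only [Sum.elim_inl, Sum.elim_inr, crossWeight] at ha' hb' ⊢
  · exact tendsto_const_nhds
  · exact tendsto_modeCoeff ha'.1 ha'.2 hb'
  · exact tendsto_modeCoeff hb'.1 hb'.2 ha'
  · exact tendsto_const_nhds

/-- The vector of a combination of sequences in the polynomial model with `N` modes. -/
def approxPoly (N : ℕ) (F : FieldAlg) : MvPolynomial ℕ ℂ :=
  ∑ Z ∈ F.coeff.support, MvPolynomial.C (F.coeff Z) *
    wickPoly twoPoint (fun a => ∑ k ∈ Finset.range N, MvPolynomial.C (modeCoeff k a) *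
        MvPolynomial.X k) Z.toList

theorem polyForm_sum {ι κ : Type*} (S : Finset ι) (T : Finset κ) (f : ι → ℂ) (g : κ → ℂ)
    (P : ι → MvPolynomial ℕ ℂ) (Q : κ → MvPolynomial ℕ ℂ) :
    polyForm (∑ i ∈ S, MvPolynomial.C (f i) * P i) (∑ j ∈ T, MvPolynomial.C (g j) * Q j) =
      ∑ i ∈ S, ∑ j ∈ T, conj (f i) * (g j * polyForm (P i) (Q j)) := by
  classical
  induction S using Finset.induction_on with
  | empty => simp [polyForm]
  | insert i S hi ih =>
    rw [Finset.sum_insert hi, Finset.sum_insert hi, polyForm_add_left, ih, polyForm_C_mul_left,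
      ← Finset.mul_sum]
    congr 2
    clear ih
    induction T using Finset.induction_on with
    | empty => simp [polyForm]
    | insert j T hj ihT =>
      rw [Finset.sum_insert hj, Finset.sum_insert hj, polyForm_add_right, ihT,
        polyForm_C_mul_right]

theorem tendsto_approxPoly (F G : DiscFields) : Filter.Tendsto
    (fun N => polyForm (approxPoly N F.incl) (approxPoly N G.incl)) Filter.atTop
    (nhds (expect (reflect F.incl * G.incl))) := by
  rw [expect_reflect_mul]
  simp only [approxPoly, polyForm_sum]
  have hF : ∀ Z ∈ F.incl.coeff.support, Z ∈ discSymbols := fun Z hZ => F.2 hZ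
  have hG : ∀ Z ∈ G.incl.coeff.support, Z ∈ discSymbols := fun Z hZ => G.2 hZ
  exact tendsto_finsetSum _ fun Z hZ => tendsto_finsetSum _ fun W hW =>
    ((tendsto_symbolForm (hF Z hZ) (hG W hW)).const_mul _).const_mul _

theorem conj_expect_reflect_mul (F G : DiscFields) :
    conj (expect (reflect G.incl * F.incl)) = expect (reflect F.incl * G.incl) := by
  refine tendsto_nhds_unique
    ((Complex.continuous_conj.tendsto _).comp (tendsto_approxPoly G F)) ?_
  simpa only [Function.comp_def, polyForm_conj] using tendsto_approxPoly F G

theorem expect_reflect_mul_self_nonneg (F : DiscFields) :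
    0 ≤ (expect (reflect F.incl * F.incl)).re :=
  ge_of_tendsto' ((Complex.continuous_re.tendsto _).comp (tendsto_approxPoly F F))
    fun _ => polyForm_self_nonneg _

/-! ### The Hilbert space -/

namespace DiscFields

/-- The reflection-positive sesquilinear form `(F, G) ↦ ⟨(Θ F) G⟩`. -/
instance core : PreInnerProductSpace.Core ℂ DiscFields where
  inner F G := expect (reflect F.incl * G.incl)
  conj_inner_symm F G := conj_expect_reflect_mul F G
  re_inner_nonneg F := expect_reflect_mul_self_nonneg F
  add_left F G K := by rw [map_add, reflect_add, add_mul, map_add]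
  smul_left F G r := by rw [map_smul, reflect_smul, smul_mul_assoc, map_smul, smul_eq_mul]

instance : SeminormedAddCommGroup DiscFields :=
  InnerProductSpace.Core.toSeminormedAddCommGroup (𝕜 := ℂ)

instance : InnerProductSpace ℂ DiscFields := InnerProductSpace.ofCore DiscFields.core

end DiscFields

/-- The Hilbert space `ℋ`: the completion of the quotient of `DiscFields` by the null space of the
form `⟨(Θ F) G⟩`. -/
abbrev ReflHilbert : Type := UniformSpace.Completion (SeparationQuotient DiscFields)

/-- The class map `ν₀`. -/
def nu0 (F : DiscFields) : ReflHilbert :=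
  ((SeparationQuotient.mk F : SeparationQuotient DiscFields) : ReflHilbert)

theorem inner_nu0 (F G : DiscFields) :
    inner ℂ (nu0 F) (nu0 G) = expect (reflect F.incl * G.incl) :=
  UniformSpace.Completion.inner_coe _ _

theorem denseRange_nu0 : DenseRange nu0 :=
  UniformSpace.Completion.denseRange_coe.comp SeparationQuotient.surjective_mk.denseRange
    (UniformSpace.Completion.continuous_coe _)

/-! ### Wick products -/

/-- The two-point function `⟨∂ᵐX(z) ∂ˡX(w)⟩ = ∂_z^{m-1} ∂_w^{l-1} ⟨∂X(z) ∂X(w)⟩`, in closed form. -/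
def derivTwoPoint (p q : ℕ+ × ℂ) : ℂ :=
  1 / 2 * ((((p.1 : ℕ) + (q.1 : ℕ) - 1)! : ℂ) * (-1) ^ (p.1 : ℕ) /
    (p.2 - q.2) ^ ((p.1 : ℕ) + (q.1 : ℕ)))

theorem derivTwoPoint_one_one (z w : ℂ) : derivTwoPoint (1, z) (1, w) = twoPoint z w := by
  simp [derivTwoPoint, twoPoint]
  ring

/-- A Wick product symbol `:[m₁, z₁, …, mₙ, zₙ]:` with `n ≥ 1`, standing for
`:∂^{m₁}X(z₁) ⋯ ∂^{mₙ}X(zₙ):`. -/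
abbrev WickSymbol : Type := {Z : List (ℕ+ × ℂ) // Z ≠ []}

/-- The free algebra on the Wick product symbols. -/
abbrev WickAlg : Type := MonoidAlgebra ℂ (FreeMonoid WickSymbol)

/-- The fields `(i, m, z)` occurring in a product of Wick products, `i` being the position of the
Wick product. -/
def legs (w : FreeMonoid WickSymbol) : List (ℕ × ℕ+ × ℂ) :=
  w.toList.zipIdx.flatMap fun p => p.1.1.map fun q => (p.2, q)

/-- The expectation of a combination of products of Wick products: the sum over the pairings of
the fields without pairs inside a Wick product. (Used only if different Wick products have no
point in common.) -/
def wickExpect : WickAlg →ₗ[ℂ] ℂ :=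
  (Finsupp.linearCombination ℂ fun w : FreeMonoid WickSymbol =>
    pairingSum (fun a b => if a.1 = b.1 then 0 else derivTwoPoint a.2 b.2) (legs w)) ∘ₗ
    (MonoidAlgebra.coeffLinearEquiv ℂ).toLinearMap

/-- The Wick product symbol `:[m, z]:` of a single field. -/
def field (m : ℕ+) (z : ℂ) : WickSymbol := ⟨[(m, z)], by simp⟩

/-- The embedding `[z₁, …, zₙ] ↦ :[1, z₁]: ⋯ :[1, zₙ]:`. -/
def toWick : FieldAlg →ₐ[ℂ] WickAlg :=
  MonoidAlgebra.mapDomainAlgHom ℂ ℂ (FreeMonoid.map (field 1))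

/-- Products of Wick products with points in the open unit disc, different factors having no point
in common. -/
def wickDiscSymbols : Set (FreeMonoid WickSymbol) :=
  {w | (∀ Z ∈ w.toList, ∀ p ∈ Z.1, ‖p.2‖ < 1) ∧
    w.toList.Pairwise fun Z Z' => ∀ p ∈ Z.1, ∀ q ∈ Z'.1, p.2 ≠ q.2}

/-- The span of `wickDiscSymbols`. -/
def wickDisc : Submodule ℂ WickAlg := MonoidAlgebra.supported ℂ ℂ wickDiscSymbols

open Classical in
/-- The vector `ν(w)` of a product of Wick products `w`: the vector of `ℋ` with
`(ν₀(G), ν(w)) = ⟨(Θ G) w⟩` for all `G`. It is unique as the range of `ν₀` is dense; that it exists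
for `w` in `wickDiscSymbols` is not obvious (the value `0` is used if it does not). -/
def nuSymbol (w : FreeMonoid WickSymbol) : ReflHilbert :=
  if h : ∃ v : ReflHilbert, ∀ G : DiscFields, inner ℂ (nu0 G) v =
      wickExpect (toWick (reflect G.incl) * MonoidAlgebra.single w 1)
  then h.choose else 0

/-- The linear map `ν`. -/
def nu : WickAlg →ₗ[ℂ] ReflHilbert :=
  (Finsupp.linearCombination ℂ nuSymbol) ∘ₗ (MonoidAlgebra.coeffLinearEquiv ℂ).toLinearMap

/-- The vacuum `Ω = ν(∅)`. -/
def vacuum : ReflHilbert := nu 1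

/-- The domain `𝒟`: the image of `wickDisc` under `ν`. -/
def domain : Submodule ℂ ReflHilbert := wickDisc.map nu

/-- The integrand `z ↦ zᵐ ν([1, z] F)` of the mode `αₘ`. -/
def modeIntegrand (m : ℤ) (F : WickAlg) (z : ℂ) : ReflHilbert :=
  z ^ m • nu (MonoidAlgebra.single (FreeMonoid.of (field 1 z)) 1 * F)

/-- All the points in `F` lie in the disc of radius `r`. -/
def Encloses (r : ℝ) (F : WickAlg) : Prop :=
  ∀ w ∈ F.coeff.support, ∀ Z ∈ w.toList, ∀ p ∈ Z.1, ‖p.2‖ < r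

theorem nu_mem_domain {F : WickAlg} (hF : F ∈ wickDisc) : nu F ∈ domain :=
  Submodule.mem_map_of_mem hF

theorem one_mem_wickDisc : (1 : WickAlg) ∈ wickDisc := by
  classical
  rw [wickDisc, MonoidAlgebra.mem_supported']
  intro w hw
  rw [MonoidAlgebra.one_def, MonoidAlgebra.coeff_single, Finsupp.single_apply, if_neg]
  rintro rfl
  exact hw (by simp [wickDiscSymbols])

/-- The mode operators `αₘ`, `m ∈ ℤ`, on `𝒟`:
`αₘ ν(F) = √2 ∮_{|z| = r} (dz / 2π) zᵐ ν([1, z] F)` for `0 < r < 1` such that the circle `|z| = r`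
encloses all the points in `F`. As `𝒟 = ν(wickDisc)`, there is at most one such family. -/
def IsModeFamily (α : ℤ → domain →ₗ[ℂ] domain) : Prop :=
  ∀ (m : ℤ) (F : WickAlg) (hF : F ∈ wickDisc) (r : ℝ), 0 < r → r < 1 → Encloses r F →
    CircleIntegrable (modeIntegrand m F) 0 r ∧
    (α m ⟨nu F, nu_mem_domain hF⟩ : ReflHilbert) =
      (((√2 : ℝ) : ℂ) / (2 * (Real.pi : ℂ))) • ∮ z in C(0, r), modeIntegrand m F z

/-- The vector `α_{-m₁} ⋯ α_{-mₙ} Ω`. -/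
def modeVector (α : ℤ → domain →ₗ[ℂ] domain) (ms : List ℕ+) : domain :=
  ms.foldr (fun m v => α (-(m : ℤ)) v) ⟨vacuum, nu_mem_domain one_mem_wickDisc⟩

/-- The Wick product `:[m₁, 0, …, mₙ, 0]:` of fields at the origin. -/
def wickOrigin (ms : List ℕ+) (h : ms ≠ []) : WickSymbol :=
  ⟨ms.map fun m => (m, 0), by simpa using h⟩

/-- Bosonic Fock space over `ℓ²(ℕ+)` in the occupation number representation: square-summable
functions of the finitely supported sequences of occupation numbers of the modes `m ≥ 1`. -/
abbrev FockSpace : Type := lp (fun _ : ℕ+ →₀ ℕ => ℂ) 2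

/-- `U` carries `Ω` to the Fock vacuum and, on `𝒟`, the operators `αₘ` and `α₋ₘ` with `m ≥ 1` to
`√m` times the annihilation and the creation operator of the mode `m`. -/
def IntertwinesModes (α : ℤ → domain →ₗ[ℂ] domain) (U : ReflHilbert ≃ₗᵢ[ℂ] FockSpace) : Prop :=
  U vacuum = lp.single 2 (0 : ℕ+ →₀ ℕ) (1 : ℂ) ∧
  ∀ (v : domain) (m : ℕ+) (n : ℕ+ →₀ ℕ),
    U (α (m : ℤ) v : ReflHilbert) n =
      ((√((m : ℝ) * (n m + 1)) : ℝ) : ℂ) * U (v : ReflHilbert) (n + Finsupp.single m 1) ∧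
    U (α (-(m : ℤ)) v : ReflHilbert) n =
      ((√((m : ℝ) * n m) : ℝ) : ℂ) * U (v : ReflHilbert) (n - Finsupp.single m 1)

end Boson

end

open Boson

/-!
Every product of Wick products has an explicit vector in Fock space, and these vectors have the
inner products prescribed by the reflected expectation; so `ℋ` can be replaced by Fock space, where
all assertions are about coordinates.

In detail, a field `∂ᵐX(z)` with `|z| < 1` is represented by the square-summable sequence `modeAmp`
of its amplitudes, the derivatives of `-i √((k + 1) / 2) zᵏ`. A product of fields becomes the
polynomial `wickPoly` in the creation operators given by Wick's theorem, which involves only a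
cutoff number of modes; `polyForm_wickPoly_linForm` computes the inner products of such polynomials
with different cutoffs, and they depend only on the smaller cutoff. Hence the vectors converge
(`tendsto_wickVec`), and the inner product of the limits is a sum over pairings (`inner_wickVec`).
As the inner product of the amplitudes of `∂X(z)` and `∂ˡX(w)` is the reflected two-point function
(`modeInner_eq_reflect`), `inner_symbolVec` identifies inner products with reflected expectations.
This gives an isometry from `ℋ` to Fock space.

Its range is dense (`eq_zero_of_inner_symbolVec`): by Wick's theorem the vectors of products of
fields at distinct points span the vectors of the Wick products of the same fields, contour integrals
around the other points turn `∂X(z)` into `∂ᵐX(0)`, and Wick products of fields at the origin are the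
multiples of the vectors of occupation numbers. So the isometry is a unitary `fockIso`, and `ν` is
its inverse applied to the explicit vectors.

The first field of a product creates a particle or is contracted with another field
(`wickVec_cons_apply`), while annihilating a particle removes one of the fields
(`wickVec_add_single`). Integrating over a circle that encloses the other fields, the creation part
of `zʲ ∂X(z)` survives for negative `j` only, and the contractions survive for positive `j` only,
where the residues are the amplitudes of the contracted fields
(`circleIntegral_zpow_mul_derivTwoPoint`). This is `IsMovingField.modeFun_eq`: the contour integrals
are the annihilation and creation operators. These preserve the span of the vectors of Wick
products, which is the image of `𝒟`, since `∂ᵐX(0)` is a multiple of a creation operator.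
-/

open Filter Topology

noncomputable section

namespace Boson

/-! ### Truncated vectors and their inner products -/

section Truncation

variable {β γ : Type*}

theorem pairingSum_map (c : γ → γ → ℂ) (g : β → γ) (L : List β) :
    pairingSum c (L.map g) = pairingSum (fun a b => c (g a) (g b)) L := by
  simpa using pairingSum_congr_picks (fun a b => c (g a) (g b)) c g (fun _ => 1) _ L rfl
    (fun _ _ _ _ => by simp)

theorem pairingSum_congr {c d : β → β → ℂ} {L : List β}
    (h : ∀ a ∈ L, ∀ b ∈ L, c a b = d a b) : pairingSum c L = pairingSum d L := by
  simpa using pairingSum_congr_picks d c id (fun _ => 1) _ L rfl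
    (fun a ha b hb => by simp [h a ha b hb])

theorem wickPoly_map (c : γ → γ → ℂ) (e : γ → MvPolynomial ℕ ℂ) (g : β → γ) (n : ℕ) :
    ∀ L : List β, L.length = n →
      wickPoly c e (L.map g) = wickPoly (fun a b => c (g a) (g b)) (fun a => e (g a)) L := by
  induction n using Nat.strong_induction_on with
  | _ n ih =>
  intro L hn
  cases L with
  | nil => simp [wickPoly]
  | cons a L =>
    rw [List.map_cons, wickPoly_cons, wickPoly_cons, picks_map, List.map_map,
      ih L.length (by simp at hn; omega) L rfl]
    congr 2
    refine List.map_congr_left fun p hp => ?_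
    have hl := length_of_mem_picks hp
    simp only [Function.comp]
    rw [ih p.2.length (by simp at hn; omega) p.2 rfl]

/-- The polynomial of the one-particle vector `x`, cut off after the first `N` modes. -/
def linForm (x : ℕ → ℂ) (N : ℕ) : MvPolynomial ℕ ℂ :=
  ∑ k ∈ Finset.range N, MvPolynomial.C (x k) * MvPolynomial.X k

/-- The weights of the pairings of a family of fields with the adjoint of another one: `c₁` and
`c₂` inside the families, `K` between them. -/
def mixedWeight (c₁ : β → β → ℂ) (c₂ : γ → γ → ℂ) (K : β → γ → ℂ) : β ⊕ γ → β ⊕ γ → ℂ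
  | .inl a, .inl b => conj (c₁ a b)
  | .inl a, .inr b => K a b
  | .inr a, .inl b => K b a
  | .inr a, .inr b => c₂ a b

/-- Vectors with different cutoffs, over different families of fields: only the modes below both
cutoffs contribute to the inner product. -/
theorem polyForm_wickPoly_linForm (c₁ : β → β → ℂ) (c₂ : γ → γ → ℂ) (x : β → ℕ → ℂ)
    (y : γ → ℕ → ℂ) (N M : ℕ) (Z : List β) (W : List γ) :
    polyForm (wickPoly c₁ (fun a => linForm (x a) N) Z)
        (wickPoly c₂ (fun b => linForm (y b) M) W) =
      pairingSum (mixedWeight c₁ c₂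
          fun a b => ∑ k ∈ Finset.range (min N M), conj (x a k) * y b k)
        (Z.map Sum.inl ++ W.map Sum.inr) := by
  let c : β ⊕ γ → β ⊕ γ → ℂ := mixedWeight (fun a b => conj (c₁ a b)) c₂ fun _ _ => 0
  let s : ℕ → β ⊕ γ → ℂ := fun k => Sum.elim (fun a => if k < N then x a k else 0)
    fun b => if k < M then y b k else 0
  have h := polyForm_wickPoly c s (max N M) _ (Z.map Sum.inl) (W.map Sum.inr) rfl
  have cut : ∀ (u : ℕ → ℂ) (N' : ℕ), N' ≤ max N M → ∑ k ∈ Finset.range (max N M),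
      MvPolynomial.C (if k < N' then u k else 0) * MvPolynomial.X k = linForm u N' := by
    intro u N' hN
    rw [linForm, ← Finset.sum_subset (Finset.range_subset_range.2 hN)]
    · refine Finset.sum_congr rfl fun k hk => ?_
      rw [if_pos (Finset.mem_range.1 hk)]
    · intro k _ hk
      rw [if_neg (by simpa using hk)]
      simp
  rw [wickPoly_map _ _ _ _ Z rfl, wickPoly_map _ _ _ _ W rfl] at h
  simp only [c, s, mixedWeight, Sum.elim_inl, Sum.elim_inr, Complex.conj_conj,
    cut _ N (le_max_left _ _), cut _ M (le_max_right _ _)] at h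
  rw [h]
  have hl : List.map Sum.inl (Z.map Sum.inl) ++ List.map Sum.inr (W.map Sum.inr) =
      (Z.map Sum.inl ++ W.map Sum.inr).map
        (Sum.map (Sum.inl : β → β ⊕ γ) (Sum.inr : γ → β ⊕ γ)) := by
    simp [Function.comp_def]
  rw [hl, pairingSum_map]
  refine pairingSum_congr fun a _ b _ => ?_
  have cut' : ∀ (u v : ℕ → ℂ), ∑ k ∈ Finset.range (max N M),
      conj (if k < N then u k else 0) * (if k < M then v k else 0) =
        ∑ k ∈ Finset.range (min N M), conj (u k) * v k := by
    intro u v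
    rw [← Finset.sum_subset (Finset.range_subset_range.2 (min_le_max (a := N) (b := M)))]
    · refine Finset.sum_congr rfl fun k hk => ?_
      have := Finset.mem_range.1 hk
      rw [if_pos (lt_of_lt_of_le this (min_le_left _ _)),
        if_pos (lt_of_lt_of_le this (min_le_right _ _))]
    · intro k _ hk
      have : ¬ (k < N ∧ k < M) := by simpa using hk
      by_cases h1 : k < N
      · rw [if_neg fun h2 => this ⟨h1, h2⟩, mul_zero]
      · rw [if_neg h1, map_zero, zero_mul]
  rcases a with a | a <;> rcases b with b | b <;>
    simp only [mixedWeight, crossWeight, Sum.map_inl, Sum.map_inr, Sum.elim_inl, Sum.elim_inr,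
      cut', Complex.conj_conj]

end Truncation

/-! ### Polynomials as vectors of Fock space -/

/-- Occupation numbers of the modes `m ≥ 1`, as exponents of the variables `X_{m-1}`. -/
def fockIndex : (ℕ+ →₀ ℕ) ≃+ (ℕ →₀ ℕ) := Finsupp.domCongr Equiv.pnatEquivNat

theorem fockIndex_single (m : ℕ+) (k : ℕ) :
    fockIndex (Finsupp.single m k) = Finsupp.single m.natPred k := by
  simp [fockIndex]

theorem fockIndex_apply (n : ℕ+ →₀ ℕ) (m : ℕ+) : fockIndex n m.natPred = n m := by
  simp [fockIndex, Finsupp.equivMapDomain_apply]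

/-- The norm of the monomial with the given exponents. -/
def fockNorm (n : ℕ+ →₀ ℕ) : ℝ := √((fockIndex n).prod fun _ k => k ! : ℕ)

theorem fockNorm_add_single (n : ℕ+ →₀ ℕ) (m : ℕ+) :
    fockNorm (n + Finsupp.single m 1) = √(n m + 1) * fockNorm n := by
  rw [fockNorm, map_add, fockIndex_single, prod_factorial_add_single, fockIndex_apply, fockNorm,
    Nat.cast_mul, Real.sqrt_mul (by positivity)]
  push_cast
  rfl

theorem fockNorm_mul_self (n : ℕ+ →₀ ℕ) :
    fockNorm n * fockNorm n = ((fockIndex n).prod fun _ k => k ! : ℕ) :=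
  Real.mul_self_sqrt (by positivity)

/-- The isometric embedding of polynomials into Fock space. -/
def fockOfPoly : MvPolynomial ℕ ℂ →ₗ[ℂ] FockSpace where
  toFun P := ⟨fun n => (fockNorm n : ℂ) * MvPolynomial.coeff (fockIndex n) P, by
    refine Memℓp.of_exponent_ge (memℓp_zero ?_) zero_le
    refine (P.support.finite_toSet.preimage fockIndex.injective.injOn).subset fun n hn => ?_
    exact MvPolynomial.mem_support_iff.2 (right_ne_zero_of_mul hn)⟩
  map_add' P Q := by
    ext n
    exact (congrArg _ (MvPolynomial.coeff_add _ P Q)).trans (mul_add _ _ _)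
  map_smul' a P := by
    ext n
    exact (congrArg _ (MvPolynomial.coeff_smul _ a P)).trans (mul_left_comm _ _ _)

theorem fockOfPoly_apply (P : MvPolynomial ℕ ℂ) (n : ℕ+ →₀ ℕ) :
    fockOfPoly P n = (fockNorm n : ℂ) * MvPolynomial.coeff (fockIndex n) P := rfl

theorem inner_fockOfPoly (P Q : MvPolynomial ℕ ℂ) :
    inner ℂ (fockOfPoly P) (fockOfPoly Q) = polyForm P Q := by
  rw [lp.inner_eq_tsum, polyForm, ← fockIndex.toEquiv.symm.tsum_eq, tsum_eq_sum (s := P.support)]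
  · refine Finset.sum_congr rfl fun n _ => ?_
    have h := congrArg (fun t : ℝ => (t : ℂ)) (fockNorm_mul_self (fockIndex.symm n))
    simp only [AddEquiv.apply_symm_apply, Complex.ofReal_mul, Complex.ofReal_natCast] at h
    simp only [AddEquiv.coe_toEquiv_symm, fockOfPoly_apply, AddEquiv.apply_symm_apply,
      RCLike.inner_apply, map_mul, Complex.conj_ofReal, ← h, AddEquiv.toEquiv_eq_coe]
    ring
  · intro n hn
    have : MvPolynomial.coeff n P = 0 := MvPolynomial.notMem_support_iff.1 hn
    simp [fockOfPoly_apply, this]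

theorem fockOfPoly_C_mul (a : ℂ) (P : MvPolynomial ℕ ℂ) :
    fockOfPoly (MvPolynomial.C a * P) = a • fockOfPoly P := by
  rw [← MvPolynomial.smul_eq_C_mul, map_smul]

theorem fockOfPoly_one : fockOfPoly 1 = lp.single 2 (0 : ℕ+ →₀ ℕ) (1 : ℂ) := by
  ext n
  rw [fockOfPoly_apply, lp.single_apply, MvPolynomial.coeff_one]
  by_cases h : n = 0
  · subst h
    simp [fockNorm]
  · have : ¬ (0 = fockIndex n) := fun h' => h (by simpa using h'.symm)
    simp [h, this]

theorem sub_single_add_single {n : ℕ+ →₀ ℕ} {m : ℕ+} (h : n m ≠ 0) :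
    n - Finsupp.single m 1 + Finsupp.single m 1 = n :=
  tsub_add_cancel_of_le (Finsupp.single_le_iff.2 (Nat.one_le_iff_ne_zero.2 h))

/-- Multiplication by a variable is a creation operator. -/
theorem fockOfPoly_X_mul (m : ℕ+) (P : MvPolynomial ℕ ℂ) (n : ℕ+ →₀ ℕ) :
    fockOfPoly (MvPolynomial.X m.natPred * P) n =
      ((√(n m) : ℝ) : ℂ) * fockOfPoly P (n - Finsupp.single m 1) := by
  by_cases h : n m = 0
  · have : m.natPred ∉ (fockIndex n).support := by
      simpa [fockIndex_apply] using h
    rw [fockOfPoly_apply, mul_comm (MvPolynomial.X _), MvPolynomial.coeff_mul_X', if_neg this]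
    simp [h]
  · obtain ⟨n, rfl⟩ : ∃ n', n = n' + Finsupp.single m 1 := ⟨_, (sub_single_add_single h).symm⟩
    rw [add_tsub_cancel_right, fockOfPoly_apply, fockNorm_add_single, map_add, fockIndex_single,
      add_comm (fockIndex n), MvPolynomial.coeff_X_mul, fockOfPoly_apply]
    simp
    ring

/-- Differentiation by a variable is an annihilation operator. -/
theorem fockOfPoly_pderiv (m : ℕ+) (P : MvPolynomial ℕ ℂ) (n : ℕ+ →₀ ℕ) :
    fockOfPoly (MvPolynomial.pderiv m.natPred P) n =
      ((√(n m + 1) : ℝ) : ℂ) * fockOfPoly P (n + Finsupp.single m 1) := by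
  have h : (((√(n m + 1) : ℝ) : ℂ)) * ((√(n m + 1) : ℝ) : ℂ) = n m + 1 := by
    rw [← Complex.ofReal_mul, Real.mul_self_sqrt (by positivity)]
    simp
  rw [fockOfPoly_apply, fockOfPoly_apply, fockNorm_add_single, MvPolynomial.coeff_pderiv, map_add,
    fockIndex_single, fockIndex_apply, ← h]
  push_cast
  ring

/-! ### Vectors of products of fields -/

section Limits

variable {E : Type*} [NormedAddCommGroup E] [InnerProductSpace ℂ E]

theorem norm_sub_sq_re (u v : E) : ‖u - v‖ ^ 2 =
    (inner ℂ u u).re - 2 * (inner ℂ u v).re + (inner ℂ v v).re := by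
  rw [norm_sub_sq (𝕜 := ℂ), ← inner_self_eq_norm_sq (𝕜 := ℂ) u, ← inner_self_eq_norm_sq (𝕜 := ℂ) v]
  rfl

theorem tendsto_of_inner {u : ℕ → E} {v : E} {g : ℂ}
    (h1 : Tendsto (fun i => inner ℂ (u i) (u i)) atTop (𝓝 g))
    (h2 : Tendsto (fun i => inner ℂ (u i) v) atTop (𝓝 g)) (h3 : inner ℂ v v = g) :
    Tendsto u atTop (𝓝 v) := by
  have h : Tendsto (fun i => ‖u i - v‖ ^ 2) atTop (𝓝 0) := by
    simp only [norm_sub_sq_re, h3]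
    have := (((Complex.continuous_re.tendsto _).comp h1).sub
      (((Complex.continuous_re.tendsto _).comp h2).const_mul 2)).add_const g.re
    rwa [show g.re - 2 * g.re + g.re = 0 by ring] at this
  rw [tendsto_iff_norm_sub_tendsto_zero]
  simpa [Function.comp_def] using (Real.continuous_sqrt.tendsto _).comp h

/-- Vectors whose inner products depend only on the smaller index form a Cauchy sequence if the
inner products converge. -/
theorem cauchySeq_of_inner {u : ℕ → E} {G : ℕ → ℂ} {g : ℂ}
    (h : ∀ N M, inner ℂ (u N) (u M) = G (min N M)) (hG : Tendsto G atTop (𝓝 g)) :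
    CauchySeq u := by
  rw [Metric.cauchySeq_iff]
  intro ε hε
  have hre := (Complex.continuous_re.tendsto _).comp hG
  obtain ⟨N₀, hN₀⟩ := Metric.tendsto_atTop.1 hre (ε ^ 2 / 4) (by positivity)
  refine ⟨N₀, fun N hN M hM => ?_⟩
  have h1 := abs_lt.1 (hN₀ N hN)
  have h2 := abs_lt.1 (hN₀ M hM)
  have h3 := abs_lt.1 (hN₀ (min N M) (le_min hN hM))
  simp only [Function.comp] at h1 h2 h3
  rw [dist_eq_norm]
  refine lt_of_pow_lt_pow_left₀ 2 hε.le ?_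
  rw [norm_sub_sq_re, h, h, h, min_self, min_self]
  linarith

end Limits

section WickVec

variable {β γ : Type*}

/-- Square summability of a sequence of amplitudes. -/
def SqSummable (x : ℕ → ℂ) : Prop := Summable fun k => ‖x k‖ ^ 2

/-- The inner product of one-particle vectors. -/
def modeInner (x y : ℕ → ℂ) : ℂ := ∑' k, conj (x k) * y k

theorem tendsto_modeInner {x y : ℕ → ℂ} (hx : SqSummable x) (hy : SqSummable y) :
    Tendsto (fun N => ∑ k ∈ Finset.range N, conj (x k) * y k) atTop (𝓝 (modeInner x y)) := by
  refine (Summable.of_norm_bounded (hx.add hy) fun k => ?_).hasSum.tendsto_sum_nat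
  rw [norm_mul, Complex.norm_conj]
  nlinarith [sq_nonneg (‖x k‖ - ‖y k‖), norm_nonneg (x k), norm_nonneg (y k)]

/-- The vector of Fock space of a product of fields `a`, with one-particle vectors `x a` and
contractions `c`: the limit of its cutoff versions. -/
def wickVec (c : β → β → ℂ) (x : β → ℕ → ℂ) (L : List β) : FockSpace :=
  limUnder atTop fun N => fockOfPoly (wickPoly c (fun a => linForm (x a) N) L)

/-- The weights of the inner product of products of fields. -/
abbrev innerWeight (c₁ : β → β → ℂ) (x : β → ℕ → ℂ) (c₂ : γ → γ → ℂ) (y : γ → ℕ → ℂ) :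
    β ⊕ γ → β ⊕ γ → ℂ :=
  mixedWeight c₁ c₂ fun a b => modeInner (x a) (y b)

theorem tendsto_mixedWeight {c₁ : β → β → ℂ} {x : β → ℕ → ℂ} {c₂ : γ → γ → ℂ}
    {y : γ → ℕ → ℂ} {Z : List β} {W : List γ} (hZ : ∀ a ∈ Z, SqSummable (x a))
    (hW : ∀ b ∈ W, SqSummable (y b)) :
    Tendsto (fun N => pairingSum (mixedWeight c₁ c₂
          fun a b => ∑ k ∈ Finset.range N, conj (x a k) * y b k)
        (Z.map Sum.inl ++ W.map Sum.inr)) atTop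
      (𝓝 (pairingSum (innerWeight c₁ x c₂ y) (Z.map Sum.inl ++ W.map Sum.inr))) := by
  refine tendsto_pairingSum _ _ _ _ rfl fun a ha b hb => ?_
  rcases a with a | a <;> rcases b with b | b <;>
    simp only [List.mem_append, List.mem_map, Sum.inl.injEq, Sum.inr.injEq, exists_eq_right,
      reduceCtorEq, and_false, exists_false, or_false, false_or] at ha hb <;>
    simp only [mixedWeight]
  · exact tendsto_const_nhds
  · exact tendsto_modeInner (hZ a ha) (hW b hb)
  · exact tendsto_modeInner (hZ b hb) (hW a ha)
  · exact tendsto_const_nhds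

theorem tendsto_wickVec (c : β → β → ℂ) {x : β → ℕ → ℂ} {L : List β}
    (hL : ∀ a ∈ L, SqSummable (x a)) :
    Tendsto (fun N => fockOfPoly (wickPoly c (fun a => linForm (x a) N) L)) atTop
      (𝓝 (wickVec c x L)) :=
  (cauchySeq_of_inner (fun N M => by
    rw [inner_fockOfPoly, polyForm_wickPoly_linForm]) (tendsto_mixedWeight hL hL)).tendsto_limUnder

theorem inner_wickVec (c₁ : β → β → ℂ) {x : β → ℕ → ℂ} (c₂ : γ → γ → ℂ) {y : γ → ℕ → ℂ}
    {Z : List β} {W : List γ} (hZ : ∀ a ∈ Z, SqSummable (x a)) (hW : ∀ b ∈ W, SqSummable (y b)) :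
    inner ℂ (wickVec c₁ x Z) (wickVec c₂ y W) =
      pairingSum (innerWeight c₁ x c₂ y) (Z.map Sum.inl ++ W.map Sum.inr) := by
  refine tendsto_nhds_unique ((tendsto_wickVec c₁ hZ).inner (tendsto_wickVec c₂ hW)) ?_
  simp only [inner_fockOfPoly, polyForm_wickPoly_linForm, min_self]
  exact tendsto_mixedWeight hZ hW

/-- The vector of a product of fields depends continuously on the contractions and the one-particle
vectors. -/
theorem tendsto_wickVec_of_tendsto {c : ℕ → β → β → ℂ} {x : ℕ → β → ℕ → ℂ} {c₀ : β → β → ℂ}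
    {x₀ : β → ℕ → ℂ} {L : List β} (hx : ∀ i, ∀ a ∈ L, SqSummable (x i a))
    (hx₀ : ∀ a ∈ L, SqSummable (x₀ a))
    (hc : ∀ a ∈ L, ∀ b ∈ L, Tendsto (fun i => c i a b) atTop (𝓝 (c₀ a b)))
    (h1 : ∀ a ∈ L, ∀ b ∈ L, Tendsto (fun i => modeInner (x i a) (x i b)) atTop
      (𝓝 (modeInner (x₀ a) (x₀ b))))
    (h2 : ∀ a ∈ L, ∀ b ∈ L, Tendsto (fun i => modeInner (x i a) (x₀ b)) atTop
      (𝓝 (modeInner (x₀ a) (x₀ b)))) :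
    Tendsto (fun i => wickVec (c i) (x i) L) atTop (𝓝 (wickVec c₀ x₀ L)) := by
  refine tendsto_of_inner ?_ ?_ (inner_wickVec c₀ c₀ hx₀ hx₀)
  · simp only [inner_wickVec _ _ (hx _) (hx _)]
    refine tendsto_pairingSum _ _ _ _ rfl fun a ha b hb => ?_
    rcases a with a | a <;> rcases b with b | b <;>
      simp only [List.mem_append, List.mem_map, Sum.inl.injEq, Sum.inr.injEq, exists_eq_right,
        reduceCtorEq, and_false, exists_false, or_false, false_or] at ha hb <;>
      simp only [mixedWeight]
    · exact (Complex.continuous_conj.tendsto _).comp (hc a ha b hb)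
    · exact h1 a ha b hb
    · exact h1 b hb a ha
    · exact hc a ha b hb
  · simp only [inner_wickVec _ _ (hx _) hx₀]
    refine tendsto_pairingSum _ _ _ _ rfl fun a ha b hb => ?_
    rcases a with a | a <;> rcases b with b | b <;>
      simp only [List.mem_append, List.mem_map, Sum.inl.injEq, Sum.inr.injEq, exists_eq_right,
        reduceCtorEq, and_false, exists_false, or_false, false_or] at ha hb <;>
      simp only [mixedWeight]
    · exact (Complex.continuous_conj.tendsto _).comp (hc a ha b hb)
    · exact h2 a ha b hb
    · exact h2 b hb a ha
    · exact tendsto_const_nhds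

theorem wickVec_map (c : γ → γ → ℂ) (x : γ → ℕ → ℂ) (g : β → γ) (L : List β) :
    wickVec c x (L.map g) = wickVec (fun a b => c (g a) (g b)) (fun a => x (g a)) L := by
  simp only [wickVec, wickPoly_map c _ g _ L rfl]

theorem tendsto_fock_apply {u : ℕ → FockSpace} {v : FockSpace} (h : Tendsto u atTop (𝓝 v))
    (n : ℕ+ →₀ ℕ) : Tendsto (fun i => u i n) atTop (𝓝 (v n)) :=
  ((continuous_apply n).comp lp.uniformContinuous_coe.continuous).continuousAt.tendsto.comp h

theorem wickVec_nil (c : β → β → ℂ) (x : β → ℕ → ℂ) :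
    wickVec c x [] = lp.single 2 (0 : ℕ+ →₀ ℕ) (1 : ℂ) := by
  have h := tendsto_wickVec c (x := x) (L := []) (by simp)
  simp only [wickPoly, fockOfPoly_one] at h
  exact tendsto_nhds_unique h tendsto_const_nhds

theorem fockOfPoly_linForm_mul (x : ℕ → ℂ) (P : MvPolynomial ℕ ℂ) (n : ℕ+ →₀ ℕ) {N : ℕ}
    (hN : ∀ m ∈ n.support, m.natPred < N) :
    fockOfPoly (linForm x N * P) n = ∑ m ∈ n.support, x m.natPred * (((√(n m) : ℝ) : ℂ) *
      fockOfPoly P (n - Finsupp.single m 1)) := by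
  have h : ∀ S : Finset ℕ, fockOfPoly ((∑ k ∈ S, MvPolynomial.C (x k) * MvPolynomial.X k) * P) n =
      ∑ k ∈ S, x k * (((√(n k.succPNat) : ℝ) : ℂ) *
        fockOfPoly P (n - Finsupp.single k.succPNat 1)) := by
    classical
    intro S
    induction S using Finset.induction_on with
    | empty => simp
    | insert k S hk ih =>
      rw [Finset.sum_insert hk, Finset.sum_insert hk, add_mul, map_add, lp.coeFn_add, Pi.add_apply,
        ih, mul_assoc, fockOfPoly_C_mul, lp.coeFn_smul, Pi.smul_apply, smul_eq_mul]
      have := fockOfPoly_X_mul k.succPNat P n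
      rw [Nat.natPred_succPNat] at this
      rw [this]
  rw [linForm, h]
  symm
  refine Finset.sum_of_injOn PNat.natPred (fun a _ b _ h => PNat.natPred_injective h)
    (fun m hm => by simpa using hN m hm) (fun k _ hk => ?_) (fun m _ => by simp)
  have : n k.succPNat = 0 := by
    by_contra h0
    exact hk ⟨k.succPNat, Finsupp.mem_support_iff.2 h0, by simp⟩
  simp [this]

theorem tendsto_list_sum_fock {ι : Type*} (l : List ι) (f : ℕ → ι → MvPolynomial ℕ ℂ)
    (v : ι → FockSpace) (h : ∀ i ∈ l, Tendsto (fun N => fockOfPoly (f N i)) atTop (𝓝 (v i))) :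
    Tendsto (fun N => fockOfPoly (l.map (f N)).sum) atTop (𝓝 (l.map v).sum) := by
  simp only [map_list_sum, List.map_map]
  exact tendsto_list_sum _ h

theorem list_sum_fock_apply {ι : Type*} (l : List ι) (v : ι → FockSpace) (n : ℕ+ →₀ ℕ) :
    (l.map v).sum n = (l.map fun i => v i n).sum := by
  induction l with
  | nil => simp
  | cons a l ih => rw [List.map_cons, List.sum_cons, lp.coeFn_add, Pi.add_apply, ih]; rfl

/-- The coordinates of a product of fields: the first field creates a particle or is contracted
with one of the others. -/
theorem wickVec_cons_apply (c : β → β → ℂ) {x : β → ℕ → ℂ} {a : β} {L : List β}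
    (hL : ∀ b ∈ a :: L, SqSummable (x b)) (n : ℕ+ →₀ ℕ) :
    wickVec c x (a :: L) n = ∑ m ∈ n.support, x a m.natPred * (((√(n m) : ℝ) : ℂ) *
        wickVec c x L (n - Finsupp.single m 1)) +
      ((picks L).map fun p => c a p.1 * wickVec c x p.2 n).sum := by
  have hL' : ∀ b ∈ L, SqSummable (x b) := fun b hb => hL b (List.mem_cons_of_mem _ hb)
  refine tendsto_nhds_unique (tendsto_fock_apply (tendsto_wickVec c hL) n) ?_
  simp only [wickPoly_cons, map_add, lp.coeFn_add, Pi.add_apply]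
  refine Tendsto.add ?_ ?_
  · have h : ∀ᶠ N in atTop, ∀ m ∈ n.support, m.natPred < N :=
      (Finset.eventually_all _).2 fun m _ => eventually_gt_atTop _
    refine Tendsto.congr' (h.mono fun N hN => (fockOfPoly_linForm_mul _ _ n hN).symm) ?_
    exact tendsto_finsetSum _ fun m _ =>
      ((tendsto_fock_apply (tendsto_wickVec c hL') _).const_mul _).const_mul _
  · have h : ((picks L).map fun p => c a p.1 * wickVec c x p.2 n) =
        (picks L).map fun p => (c a p.1 • wickVec c x p.2) n := rfl
    rw [h, ← list_sum_fock_apply]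
    refine tendsto_fock_apply (tendsto_list_sum_fock _ _ _ fun p hp => ?_) n
    simp only [fockOfPoly_C_mul]
    exact (tendsto_wickVec c fun b hb => hL' b ((mem_of_mem_picks hp).2 b hb)).const_smul _

theorem pderiv_linForm (x : ℕ → ℂ) {k N : ℕ} (hk : k < N) :
    MvPolynomial.pderiv k (linForm x N) = MvPolynomial.C (x k) := by
  classical
  simp only [linForm, map_sum, MvPolynomial.pderiv_C_mul, MvPolynomial.pderiv_X, Pi.single_apply]
  rw [Finset.sum_eq_single k]
  · simp
  · intro b _ hb; simp [hb]
  · exact fun h => absurd (Finset.mem_range.2 hk) h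

/-- Annihilating a particle in a product of fields removes one of the fields. -/
theorem wickVec_add_single (c : β → β → ℂ) {x : β → ℕ → ℂ} {L : List β}
    (hL : ∀ b ∈ L, SqSummable (x b)) (m : ℕ+) (n : ℕ+ →₀ ℕ) :
    ((√(n m + 1) : ℝ) : ℂ) * wickVec c x L (n + Finsupp.single m 1) =
      ((picks L).map fun p => x p.1 m.natPred * wickVec c x p.2 n).sum := by
  refine tendsto_nhds_unique
    ((tendsto_fock_apply (tendsto_wickVec c hL) (n + Finsupp.single m 1)).const_mul _) ?_
  simp only [← fockOfPoly_pderiv]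
  -- The derivative removes one of the fields as soon as the cutoff exceeds the mode.
  refine Tendsto.congr' ((eventually_gt_atTop m.natPred).mono fun N hN =>
    congrArg (fun P => fockOfPoly P n) (pderiv_wickPoly c _ m.natPred (fun a => x a m.natPred)
      (fun a => pderiv_linForm (x a) hN) _ L rfl).symm) ?_
  have h : ((picks L).map fun p => x p.1 m.natPred * wickVec c x p.2 n) =
      (picks L).map fun p => (x p.1 m.natPred • wickVec c x p.2) n := rfl
  rw [h, ← list_sum_fock_apply]
  refine tendsto_fock_apply (tendsto_list_sum_fock _ _ _ fun p hp => ?_) n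
  simp only [fockOfPoly_C_mul]
  exact (tendsto_wickVec c fun b hb => hL b ((mem_of_mem_picks hp).2 b hb)).const_smul _

theorem sublist_of_mem_picks : ∀ {L : List β} {p : β × List β}, p ∈ picks L → p.2.Sublist L
  | [], p, h => by simp [picks] at h
  | a :: L, p, h => by
      simp only [picks, List.mem_cons, List.mem_map] at h
      rcases h with rfl | ⟨q, hq, rfl⟩
      · exact List.sublist_cons_self _ _
      · exact (sublist_of_mem_picks hq).cons_cons a

/-- Wick's theorem: a product of fields is the product without contractions plus a combination of
such products of fewer of the fields, with coefficients that do not depend on the vectors. -/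
theorem exists_wickPoly_eq (c : β → β → ℂ) (n : ℕ) : ∀ L : List β, L.length = n →
    ∃ T : List (ℂ × List β), (∀ t ∈ T, t.2.Sublist L ∧ t.2.length < L.length) ∧
      ∀ e : β → MvPolynomial ℕ ℂ, wickPoly c e L = wickPoly (fun _ _ => 0) e L +
        (T.map fun t => MvPolynomial.C t.1 * wickPoly (fun _ _ => 0) e t.2).sum := by
  induction n using Nat.strong_induction_on with
  | _ n ih =>
  intro L hn
  cases L with
  | nil => exact ⟨[], by simp, fun e => by simp [wickPoly]⟩
  | cons a L =>
    have h0 : ∀ (e : β → MvPolynomial ℕ ℂ) (M : List β),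
        wickPoly (fun _ _ => 0) e (a :: M) = e a * wickPoly (fun _ _ => 0) e M := by
      intro e M
      rw [wickPoly_cons]
      simp
    obtain ⟨T, hT, hT'⟩ := ih L.length (by simp at hn; omega) L rfl
    have key : ∀ l : List (β × List β), (∀ p ∈ l, p ∈ picks L) →
        ∃ T : List (ℂ × List β),
          (∀ t ∈ T, t.2.Sublist (a :: L) ∧ t.2.length < (a :: L).length) ∧
          ∀ e : β → MvPolynomial ℕ ℂ,
            (l.map fun p => MvPolynomial.C (c a p.1) * wickPoly c e p.2).sum =
              (T.map fun t => MvPolynomial.C t.1 * wickPoly (fun _ _ => 0) e t.2).sum := by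
      intro l hl
      induction l with
      | nil => exact ⟨[], by simp, fun e => by simp⟩
      | cons p l ihl =>
        obtain ⟨T₁, h1, h1'⟩ := ihl fun q hq => hl q (List.mem_cons_of_mem _ hq)
        have hp := hl p (by simp)
        have hlen := length_of_mem_picks hp
        have hsub : p.2.Sublist (a :: L) := (sublist_of_mem_picks hp).cons a
        obtain ⟨T₂, h2, h2'⟩ := ih p.2.length (by simp at hn; omega) p.2 rfl
        refine ⟨(c a p.1, p.2) :: (T₂.map fun t => (c a p.1 * t.1, t.2)) ++ T₁, ?_, ?_⟩
        · intro t ht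
          simp only [List.cons_append, List.mem_cons, List.mem_append, List.mem_map] at ht
          rcases ht with rfl | ⟨t', ht', rfl⟩ | ht
          · exact ⟨hsub, by simp; omega⟩
          · exact ⟨(h2 t' ht').1.trans hsub, (h2 t' ht').2.trans (by simp; omega)⟩
          · exact h1 t ht
        · intro e
          simp only [List.cons_append, List.map_cons, List.map_append, List.map_map,
            List.sum_cons, List.sum_append, h1' e, h2' e, mul_add, ← List.sum_map_mul_left,
            Function.comp_def, map_mul, mul_assoc, add_assoc]
    obtain ⟨T', h1, h2⟩ := key (picks L) fun _ h => h
    refine ⟨(T.map fun t => (t.1, a :: t.2)) ++ T', ?_, fun e => ?_⟩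
    · intro t ht
      simp only [List.mem_append, List.mem_map] at ht
      rcases ht with ⟨t', ht', rfl⟩ | ht
      · exact ⟨(hT t' ht').1.cons_cons a, by simpa using (hT t' ht').2⟩
      · exact h1 t ht
    · rw [wickPoly_cons, h2, hT' e, mul_add, ← List.sum_map_mul_left]
      simp only [List.map_append, List.sum_append, List.map_map, Function.comp_def, h0,
        mul_left_comm (e a), add_assoc]

/-- Wick's theorem for the limits of the cutoff vectors. -/
theorem exists_wickVec_eq (c : β → β → ℂ) (L : List β) :
    ∃ T : List (ℂ × List β), (∀ t ∈ T, t.2.Sublist L ∧ t.2.length < L.length) ∧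
      ∀ x : β → ℕ → ℂ, (∀ a ∈ L, SqSummable (x a)) → wickVec c x L =
        wickVec (fun _ _ => 0) x L +
          (T.map fun t => t.1 • wickVec (fun _ _ => 0) x t.2).sum := by
  obtain ⟨T, hT, h⟩ := exists_wickPoly_eq c _ L rfl
  refine ⟨T, hT, fun x hx => tendsto_nhds_unique (tendsto_wickVec c hx) ?_⟩
  simp only [h, map_add]
  refine (tendsto_wickVec _ hx).add (tendsto_list_sum_fock _ _ _ fun t ht => ?_)
  simp only [fockOfPoly_C_mul]
  exact (tendsto_wickVec _ fun a ha => hx a ((hT t ht).1.subset ha)).const_smul _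

end WickVec

/-! ### The one-particle vectors of the fields -/

/-- The one-particle vector of `∂ᵐX(z)`: the derivative of order `m - 1` in `z` of
`-i √((k + 1) / 2) zᵏ`. The phase `-i` is the one for which the modes of the field become creation
and annihilation operators without phases. -/
def modeAmp (p : ℕ+ × ℂ) (k : ℕ) : ℂ :=
  -Complex.I * ((√((k + 1) / 2) : ℝ) : ℂ) * (k.descFactorial p.1.natPred : ℂ) *
    p.2 ^ (k - p.1.natPred)

theorem modeAmp_one (z : ℂ) (k : ℕ) :
    modeAmp (1, z) k = -Complex.I * ((√((k + 1) / 2) : ℝ) : ℂ) * z ^ k := by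
  have : (1 : ℕ+).natPred = 0 := rfl
  simp [modeAmp, this]

theorem modeAmp_zero (m : ℕ+) {k : ℕ} (hk : k ≠ m.natPred) : modeAmp (m, 0) k = 0 := by
  rcases lt_or_gt_of_ne hk with h | h
  · simp [modeAmp, Nat.descFactorial_eq_zero_iff_lt.2 h]
  · simp [modeAmp, Nat.sub_ne_zero_of_lt h]

theorem modeAmp_zero_self (m : ℕ+) : modeAmp (m, 0) m.natPred =
    -Complex.I * ((√((m : ℝ) / 2) : ℝ) : ℂ) * (((m : ℕ) - 1)! : ℂ) := by
  have : ((m.natPred : ℝ) + 1) = m := by exact_mod_cast m.natPred_add_one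
  simp [modeAmp, Nat.descFactorial_self, this]
  simp [PNat.natPred]

theorem norm_modeAmp_add_sq (p : ℕ+ × ℂ) (j : ℕ) : ‖modeAmp p (j + p.1.natPred)‖ ^ 2 =
    ((j + p.1.natPred + 1 : ℕ) : ℝ) / 2 * ((j + p.1.natPred).descFactorial p.1.natPred : ℝ) ^ 2 *
      (‖p.2‖ ^ 2) ^ j := by
  simp only [modeAmp, norm_mul, norm_neg, Complex.norm_I, one_mul, Complex.norm_real,
    Complex.norm_natCast, norm_pow, add_tsub_cancel_right, Real.norm_eq_abs, mul_pow, sq_abs]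
  rw [Real.sq_sqrt (by positivity)]
  push_cast
  ring

theorem sqSummable_modeAmp {p : ℕ+ × ℂ} (hp : ‖p.2‖ < 1) : SqSummable (modeAmp p) := by
  rw [SqSummable, ← summable_nat_add_iff p.1.natPred]
  set d := p.1.natPred
  have hr : ‖(‖p.2‖ ^ 2 : ℝ)‖ < 1 := by
    rw [norm_pow, norm_norm]
    exact pow_lt_one₀ (norm_nonneg _) hp two_ne_zero
  refine Summable.of_nonneg_of_le (fun _ => sq_nonneg _) (fun j => ?_)
    (summable_descFactorial_mul_geometric_of_norm_lt_one (2 * d + 1) hr)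
  rw [norm_modeAmp_add_sq]
  refine mul_le_mul_of_nonneg_right ?_ (by positivity)
  -- Up to the factor `1 / 2` the weight is a product of at most `2 d + 1` factors
  -- between `j + 1` and `j + d + 1`.
  have h : (j + d + 1) * (j + d).descFactorial d ^ 2 ≤
      (j + (2 * d + 1)).descFactorial (2 * d + 1) := by
    have h1 := Nat.descFactorial_mul_descFactorial (k := d + 1) (m := 2 * d + 1)
      (n := j + (2 * d + 1)) (by omega)
    have h2 := Nat.pow_sub_le_descFactorial (j + (2 * d + 1)) (d + 1)
    have h3 := Nat.descFactorial_le_pow (j + d) d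
    have e1 : j + (2 * d + 1) - (d + 1) = j + d := by omega
    have e2 : 2 * d + 1 - (d + 1) = d := by omega
    have e3 : j + (2 * d + 1) + 1 - (d + 1) = j + d + 1 := by omega
    rw [e1, e2] at h1
    rw [e3] at h2
    calc (j + d + 1) * (j + d).descFactorial d ^ 2
        = (j + d).descFactorial d * ((j + d + 1) * (j + d).descFactorial d) := by ring
      _ ≤ (j + d).descFactorial d * ((j + d + 1) * (j + d + 1) ^ d) := by
        gcongr
        exact h3.trans (Nat.pow_le_pow_left (Nat.le_succ _) d)
      _ ≤ (j + d).descFactorial d * (j + (2 * d + 1)).descFactorial (d + 1) := by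
        gcongr
        rw [← pow_succ']
        exact h2
      _ = _ := h1
  have h' : ((j + d + 1 : ℕ) : ℝ) * ((j + d).descFactorial d : ℝ) ^ 2 ≤
      ((j + (2 * d + 1)).descFactorial (2 * d + 1) : ℝ) := by exact_mod_cast h
  have h0 : 0 ≤ ((j + d + 1 : ℕ) : ℝ) * ((j + d).descFactorial d : ℝ) ^ 2 := by positivity
  linarith

/-- The inner product of the one-particle vectors of `∂X(z)` and `∂ˡX(w)`. -/
theorem modeInner_modeAmp {z w : ℂ} (hz : ‖z‖ < 1) (l : ℕ+) (hw : ‖w‖ < 1) :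
    modeInner (modeAmp (1, z)) (modeAmp (l, w)) =
      1 / 2 * (l : ℕ)! * conj z ^ l.natPred / (1 - conj z * w) ^ ((l : ℕ) + 1) := by
  have hn : ‖conj z * w‖ < 1 := by
    rw [norm_mul, Complex.norm_conj]
    exact mul_lt_one_of_nonneg_of_lt_one_left (norm_nonneg _) hz hw.le
  set d := l.natPred with hd
  have hl : (l : ℕ) = d + 1 := l.natPred_add_one.symm
  have h := (hasSum_choose_mul_geometric_of_norm_lt_one (l : ℕ) hn).mul_left
    (1 / 2 * (l : ℕ)! * conj z ^ d)
  rw [mul_one_div] at h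
  have hterm : ∀ j : ℕ, conj (modeAmp (1, z) (j + d)) * modeAmp (l, w) (j + d) =
      1 / 2 * (l : ℕ)! * conj z ^ d * (((j + (l : ℕ)).choose l : ℂ) * (conj z * w) ^ j) := by
    intro j
    have hs : ((√(((j + d : ℕ) + 1) / 2) : ℝ) : ℂ) * ((√(((j + d : ℕ) + 1) / 2) : ℝ) : ℂ) =
        ((j + d : ℕ) + 1) / 2 := by
      rw [← Complex.ofReal_mul, Real.mul_self_sqrt (by positivity)]
      push_cast; ring
    have hc : (((j + d : ℕ) : ℂ) + 1) * ((j + d).descFactorial d : ℂ) =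
        (l : ℕ)! * ((j + (l : ℕ)).choose l : ℂ) := by
      have := Nat.succ_descFactorial_succ (j + d) d
      rw [Nat.descFactorial_eq_factorial_mul_choose (j + d + 1)] at this
      rw [hl, ← add_assoc]
      exact_mod_cast this.symm
    simp only [modeAmp_one]
    simp only [modeAmp, ← hd, map_mul, map_neg, Complex.conj_I, Complex.conj_ofReal, map_pow,
      add_tsub_cancel_right, neg_neg]
    calc _ = -(Complex.I * Complex.I) * (((√(((j + d : ℕ) + 1) / 2) : ℝ) : ℂ) *
          ((√(((j + d : ℕ) + 1) / 2) : ℝ) : ℂ)) * ((j + d).descFactorial d : ℂ) *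
          (conj z ^ (j + d) * w ^ j) := by ring
      _ = 1 / 2 * ((((j + d : ℕ) : ℂ) + 1) * ((j + d).descFactorial d : ℂ)) *
          (conj z ^ (j + d) * w ^ j) := by rw [hs, Complex.I_mul_I]; ring
      _ = _ := by rw [hc, mul_pow, pow_add]; ring
  simp only [← hterm] at h
  generalize 1 / 2 * ((l : ℕ)! : ℂ) * conj z ^ d / (1 - conj z * w) ^ ((l : ℕ) + 1) = v at h ⊢
  refine HasSum.tsum_eq (((add_left_injective d).hasSum_iff
    (f := fun k => conj (modeAmp (1, z) k) * modeAmp (l, w) k) ?_).1 h)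
  intro k hk
  have : k < d := by
    by_contra hkd
    exact hk ⟨k - d, Nat.sub_add_cancel (not_lt.1 hkd)⟩
  simp [modeAmp, ← hd, Nat.descFactorial_eq_zero_iff_lt.2 this]

theorem one_sub_conj_mul_ne_zero {z w : ℂ} (hz : ‖z‖ < 1) (hw : ‖w‖ < 1) :
    1 - conj z * w ≠ 0 := by
  have hn : ‖conj z * w‖ < 1 := by
    rw [norm_mul, Complex.norm_conj]
    exact mul_lt_one_of_nonneg_of_lt_one_left (norm_nonneg _) hz hw.le
  intro h0
  rw [← sub_eq_zero.1 h0] at hn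
  simp at hn

/-- The inner products of the one-particle vectors are the reflected two-point functions. -/
theorem modeInner_eq_reflect {z w : ℂ} (hz0 : z ≠ 0) (hz : ‖z‖ < 1) (l : ℕ+) (hw : ‖w‖ < 1) :
    modeInner (modeAmp (1, z)) (modeAmp (l, w)) =
      -1 / conj z ^ 2 * derivTwoPoint (1, 1 / conj z) (l, w) := by
  rw [modeInner_modeAmp hz l hw, derivTwoPoint]
  have hcz : conj z ≠ 0 := by simpa using hz0
  have h1 := one_sub_conj_mul_ne_zero hz hw
  have hl : (l : ℕ) = l.natPred + 1 := l.natPred_add_one.symm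
  have h3 : 1 / conj z - w = (1 - conj z * w) / conj z := by field_simp
  simp only [h3, PNat.one_coe, add_tsub_cancel_left, pow_one, div_pow]
  rw [add_comm 1 (l : ℕ)]
  generalize (l : ℕ)! = f
  rw [hl]
  field_simp
  ring

theorem derivTwoPoint_comm (p q : ℕ+ × ℂ) : derivTwoPoint p q = derivTwoPoint q p := by
  have h : (p.2 - q.2) ^ ((p.1 : ℕ) + (q.1 : ℕ)) =
      (-1) ^ ((p.1 : ℕ) + (q.1 : ℕ)) * (q.2 - p.2) ^ ((q.1 : ℕ) + (p.1 : ℕ)) := by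
    rw [← neg_sub q.2 p.2, neg_pow, add_comm (q.1 : ℕ)]
  rw [derivTwoPoint, derivTwoPoint, h, add_comm (q.1 : ℕ) (p.1 : ℕ), pow_add]
  rcases Nat.even_or_odd (p.1 : ℕ) with hp | hp <;> rcases Nat.even_or_odd (q.1 : ℕ) with hq | hq <;>
    rw [hp.neg_one_pow, hq.neg_one_pow] <;> ring

theorem derivTwoPoint_one (z : ℂ) (q : ℕ+ × ℂ) :
    derivTwoPoint (1, z) q = -(1 / 2) * ((q.1 : ℕ)! : ℂ) * (1 / (z - q.2) ^ ((q.1 : ℕ) + 1)) := by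
  simp only [derivTwoPoint, PNat.one_coe, add_tsub_cancel_left, pow_one]
  rw [add_comm 1 (q.1 : ℕ)]
  ring

/-! ### The vectors of products of Wick products -/

/-- The contractions between the fields of a product of Wick products. -/
def legWeight (a b : ℕ × ℕ+ × ℂ) : ℂ := if a.1 = b.1 then 0 else derivTwoPoint a.2 b.2

/-- The vector of Fock space of a product of Wick products. -/
def symbolVec (w : FreeMonoid WickSymbol) : FockSpace :=
  wickVec legWeight (fun a => modeAmp a.2) (legs w)

theorem legs_mul (u w : FreeMonoid WickSymbol) : legs (u * w) =
    legs u ++ (legs w).map fun a => (u.toList.length + a.1, a.2) := by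
  rw [legs, FreeMonoid.toList_mul, List.zipIdx_append, List.flatMap_append, legs, zero_add,
    List.zipIdx_eq_map_add (i := u.toList.length), legs, List.map_flatMap, List.flatMap_map]
  simp [Function.comp_def]

theorem exists_of_mem_legs {w : FreeMonoid WickSymbol} {a : ℕ × ℕ+ × ℂ} (ha : a ∈ legs w) :
    a.1 < w.toList.length ∧ ∃ Z ∈ w.toList, a.2 ∈ Z.1 := by
  simp only [legs, List.mem_flatMap, List.mem_map] at ha
  obtain ⟨⟨Z, i⟩, hZ, q, hq, rfl⟩ := ha
  have := List.mem_zipIdx hZ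
  exact ⟨by simpa using this.2.1, Z, List.fst_mem_of_mem_zipIdx hZ, hq⟩

theorem legs_of (Z : WickSymbol) : legs (FreeMonoid.of Z) = Z.1.map fun q => (0, q) := by
  simp [legs, FreeMonoid.toList_of]

theorem legs_map_field (Z : FreeMonoid ℂ) : legs (FreeMonoid.map (field 1) Z) =
    Z.toList.zipIdx.map fun p => (p.2, 1, p.1) := by
  rw [legs, FreeMonoid.toList_map, List.zipIdx_map, List.flatMap_map]
  simp [field, ← List.map_eq_flatMap]

/-- Both expectations agree without restrictions on the points, since coinciding points contribute
`0` to either side. -/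
theorem expect_eq_wickExpect (F : FieldAlg) : expect F = wickExpect (toWick F) := by
  have h : expect = wickExpect ∘ₗ toWick.toLinearMap := by
    refine MonoidAlgebra.lhom_ext' fun Z => LinearMap.ext_ring ?_
    have h1 : pairingSum twoPoint Z.toList =
        pairingSum legWeight (legs (FreeMonoid.map (field 1) Z)) := by
      conv_lhs => rw [← List.zipIdx_map_fst 0 Z.toList]
      rw [legs_map_field, pairingSum_map, pairingSum_map]
      refine pairingSum_congr fun p hp q hq => ?_
      rw [legWeight, derivTwoPoint_one_one]
      split_ifs with hpq
      · -- The same entry: the two-point function at coinciding points is `0` by convention.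
        have hp' := List.mem_zipIdx_iff_getElem?.1 hp
        have hq' := List.mem_zipIdx_iff_getElem?.1 hq
        simp only at hpq
        rw [hpq, hq'] at hp'
        simp [twoPoint, Option.some.inj hp']
      · rfl
    simp [expect, wickExpect, toWick]
    exact h1
  exact congrArg (fun f : FieldAlg →ₗ[ℂ] ℂ => f F) h

/-- The points of a product of Wick products lie in the unit disc. -/
def InDisc (w : FreeMonoid WickSymbol) : Prop := ∀ Z ∈ w.toList, ∀ p ∈ Z.1, ‖p.2‖ < 1

theorem InDisc.norm_lt_one {w : FreeMonoid WickSymbol} (hw : InDisc w) {a : ℕ × ℕ+ × ℂ}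
    (ha : a ∈ legs w) : ‖a.2.2‖ < 1 := by
  obtain ⟨-, Z, hZ, h⟩ := exists_of_mem_legs ha
  exact hw Z hZ _ h

theorem inDisc_map_field {Z : FreeMonoid ℂ} (hZ : Z ∈ discSymbols) :
    InDisc (FreeMonoid.map (field 1) Z) := by
  intro S hS p hp
  rw [FreeMonoid.toList_map, List.mem_map] at hS
  obtain ⟨z, hz, rfl⟩ := hS
  simp only [field, List.mem_singleton] at hp
  subst hp
  exact (hZ.2 z hz).2

/-- The inner products of the vectors of products of fields are the reflected expectations. -/
theorem inner_symbolVec {Z : FreeMonoid ℂ} (hZ : Z ∈ discSymbols) {w : FreeMonoid WickSymbol}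
    (hw : InDisc w) :
    inner ℂ (symbolVec (FreeMonoid.map (field 1) Z)) (symbolVec w) =
      (Z.toList.map fun z => -1 / conj z ^ 2).prod * pairingSum legWeight
        (legs (FreeMonoid.map (field 1) (FreeMonoid.map (fun z => 1 / conj z) Z) * w)) := by
  have hZ' := inDisc_map_field hZ
  rw [symbolVec, symbolVec, inner_wickVec _ _ (fun a ha => sqSummable_modeAmp (hZ'.norm_lt_one ha))
    fun a ha => sqSummable_modeAmp (hw.norm_lt_one ha)]
  have hmem : ∀ a ∈ legs (FreeMonoid.map (field 1) Z), a.1 < Z.toList.length ∧ a.2.1 = 1 ∧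
      a.2.2 ≠ 0 ∧ ‖a.2.2‖ < 1 := by
    intro a ha
    have h1 := (exists_of_mem_legs ha).1
    rw [legs_map_field, List.mem_map] at ha
    obtain ⟨p, hp, rfl⟩ := ha
    have := hZ.2 p.1 (List.fst_mem_of_mem_zipIdx hp)
    exact ⟨by simpa [FreeMonoid.toList_map] using h1, rfl, this.1, this.2⟩
  have h := pairingSum_congr_picks (innerWeight legWeight (fun a => modeAmp a.2) legWeight
      fun a => modeAmp a.2) legWeight
    (Sum.elim (fun a => (a.1, a.2.1, 1 / conj a.2.2)) fun a => (Z.toList.length + a.1, a.2))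
    (Sum.elim (fun a => -1 / conj a.2.2 ^ 2) fun _ => 1) _
    ((legs (FreeMonoid.map (field 1) Z)).map Sum.inl ++ (legs w).map Sum.inr) rfl (by
      intro a ha b hb
      rcases a with a | a <;> rcases b with b | b <;>
        simp only [List.mem_append, List.mem_map, Sum.inl.injEq, Sum.inr.injEq, exists_eq_right,
          reduceCtorEq, and_false, exists_false, or_false, false_or] at ha hb <;>
        simp only [mixedWeight, Sum.elim_inl, Sum.elim_inr]
      · obtain ⟨i, m, z⟩ := a
        obtain ⟨j, l, w'⟩ := b
        obtain ⟨-, rfl, hz, -⟩ := hmem _ ha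
        obtain ⟨-, rfl, hw', -⟩ := hmem _ hb
        have hz' : conj z ≠ 0 := by simpa using hz
        have hw'' : conj w' ≠ 0 := by simpa using hw'
        simp only [legWeight]
        split_ifs
        · simp
        · simp only [derivTwoPoint_one_one]
          rw [twoPoint_reflect hz hw']
          field_simp
      · obtain ⟨i, m, z⟩ := a
        obtain ⟨hi, rfl, hz0, hz⟩ := hmem _ ha
        have hne : ¬ i = Z.toList.length + b.1 := by simp at hi; omega
        simp only [legWeight, if_neg hne]
        rw [show b.2 = (b.2.1, b.2.2) from rfl,
          modeInner_eq_reflect hz0 hz b.2.1 (hw.norm_lt_one hb)]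
        ring
      · obtain ⟨i, m, z⟩ := b
        obtain ⟨hi, rfl, hz0, hz⟩ := hmem _ hb
        have hne : ¬ Z.toList.length + a.1 = i := by simp at hi; omega
        simp only [legWeight, if_neg hne]
        rw [derivTwoPoint_comm, show a.2 = (a.2.1, a.2.2) from rfl,
          modeInner_eq_reflect hz0 hz a.2.1 (hw.norm_lt_one ha)]
        ring
      · simp [legWeight])
  rw [← h, legs_mul]
  congr 1
  · rw [legs_map_field]
    have hf : ∀ f : ℂ → ℂ, Z.toList.map f = Z.toList.zipIdx.map fun p => f p.1 := by
      intro f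
      conv_lhs => rw [← List.zipIdx_map_fst 0 Z.toList, List.map_map]
      rfl
    simp [hf, Function.comp_def]
  · rw [legs_map_field, legs_map_field]
    simp [FreeMonoid.toList_map, List.zipIdx_map, Function.comp_def]

/-! ### Contour integrals of the two-point function -/

section Contour

variable {r : ℝ} {w : ℂ}

theorem ne_zero_of_mem_sphere (hr : 0 < r) {z : ℂ} (hz : z ∈ Metric.sphere (0 : ℂ) r) : z ≠ 0 := by
  rintro rfl
  simp at hz
  exact hr.ne hz

theorem sub_ne_zero_of_mem_sphere (hw : ‖w‖ < r) {z : ℂ} (hz : z ∈ Metric.sphere (0 : ℂ) r) :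
    z - w ≠ 0 := by
  intro h
  rw [sub_eq_zero.1 h] at hz
  simp at hz
  exact hw.ne hz

theorem continuousOn_inv_pow_mul (hr : 0 < r) (hw : ‖w‖ < r) (a b : ℕ) :
    ContinuousOn (fun z : ℂ => (z ^ a)⁻¹ * ((z - w) ^ b)⁻¹) (Metric.sphere 0 r) :=
  ((continuousOn_id.pow a).inv₀ fun _ hz => pow_ne_zero _ (ne_zero_of_mem_sphere hr hz)).mul
    (((continuousOn_id.sub continuousOn_const).pow b).inv₀ fun _ hz =>
      pow_ne_zero _ (sub_ne_zero_of_mem_sphere hw hz))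

theorem circleIntegral_inv_sub_pow (r : ℝ) (w : ℂ) {b : ℕ} (hb : b ≠ 1) :
    (∮ z in C(0, r), ((z - w) ^ b)⁻¹) = 0 := by
  simp only [← zpow_natCast, ← zpow_neg]
  exact circleIntegral.integral_sub_zpow_of_ne (by omega) _ _ _

/-- A function that decays at infinity at least like `z⁻²` and is holomorphic outside the circle
has no contour integral; here by partial fractions. -/
theorem circleIntegral_inv_pow_mul (hr : 0 < r) (hw : ‖w‖ < r) (s : ℕ) : ∀ a b : ℕ, a + b = s →
    2 ≤ s → (∮ z in C(0, r), (z ^ a)⁻¹ * ((z - w) ^ b)⁻¹) = 0 := by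
  have h0 : ‖(0 : ℂ)‖ < r := by simpa using hr
  rcases eq_or_ne w 0 with rfl | hw0
  · intro a b hab hs
    have := circleIntegral_inv_sub_pow r 0 (b := a + b) (by omega)
    simpa only [sub_zero, pow_add, mul_inv] using this
  induction s with
  | zero => omega
  | succ s ih =>
  intro a b hab hs
  rcases a with _ | a
  · simpa using circleIntegral_inv_sub_pow r w (b := b) (by omega)
  rcases b with _ | b
  · simpa using circleIntegral_inv_sub_pow r 0 (b := a + 1) (by omega)
  have hsplit : (∮ z in C(0, r), (z ^ (a + 1))⁻¹ * ((z - w) ^ (b + 1))⁻¹) =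
      ∮ z in C(0, r), w⁻¹ * ((z ^ a)⁻¹ * ((z - w) ^ (b + 1))⁻¹ -
        (z ^ (a + 1))⁻¹ * ((z - w) ^ b)⁻¹) := by
    refine circleIntegral.integral_congr hr.le fun z hz => ?_
    have h1 := ne_zero_of_mem_sphere hr hz
    have h2 := sub_ne_zero_of_mem_sphere hw hz
    field_simp
    ring
  rw [hsplit, circleIntegral.integral_const_mul, circleIntegral.integral_sub
    ((continuousOn_inv_pow_mul hr hw _ _).circleIntegrable hr.le)
    ((continuousOn_inv_pow_mul hr hw _ _).circleIntegrable hr.le)]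
  rcases Nat.lt_or_ge s 2 with h | h
  · obtain ⟨rfl, rfl⟩ : a = 0 ∧ b = 0 := by omega
    have e1 := circleIntegral.integral_sub_inv_of_mem_ball (c := 0) (w := w) (R := r) (by simpa)
    have e2 := circleIntegral.integral_sub_inv_of_mem_ball (c := 0) (w := 0) (R := r) (by simpa)
    simp only [sub_zero] at e2
    simp [e1, e2]
  · rw [ih a (b + 1) (by omega) h, ih (a + 1) b (by omega) h]
    simp

theorem circleIntegral_pow_mul_inv (hr : 0 < r) (hw : ‖w‖ < r) (M l : ℕ) :
    (∮ z in C(0, r), z ^ M * ((z - w) ^ (l + 1))⁻¹) =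
      2 * Real.pi * Complex.I * (M.choose l : ℂ) * w ^ (M - l) := by
  have hterm : ∀ i : ℕ, (∮ z in C(0, r), (z - w) ^ i * ((z - w) ^ (l + 1))⁻¹) =
      if i = l then 2 * Real.pi * Complex.I else 0 := by
    intro i
    have : (∮ z in C(0, r), (z - w) ^ i * ((z - w) ^ (l + 1))⁻¹) =
        ∮ z in C(0, r), (z - w) ^ ((i : ℤ) - (l + 1 : ℕ)) := by
      refine circleIntegral.integral_congr hr.le fun z hz => ?_
      rw [zpow_sub₀ (sub_ne_zero_of_mem_sphere hw hz), zpow_natCast, zpow_natCast, div_eq_mul_inv]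
    rw [this]
    split_ifs with h
    · subst h
      have e : ((i : ℤ) - (i + 1 : ℕ)) = -1 := by push_cast; ring
      simp only [e, zpow_neg_one]
      exact circleIntegral.integral_sub_inv_of_mem_ball (by simpa)
    · exact circleIntegral.integral_sub_zpow_of_ne (by push_cast; omega) _ _ _
  have hexp : ∀ z : ℂ, z ^ M * ((z - w) ^ (l + 1))⁻¹ = ∑ i ∈ Finset.range (M + 1),
      (w ^ (M - i) * (M.choose i : ℂ)) * ((z - w) ^ i * ((z - w) ^ (l + 1))⁻¹) := by
    intro z
    conv_lhs => rw [← sub_add_cancel z w, add_pow, Finset.sum_mul]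
    rw [sub_add_cancel]
    exact Finset.sum_congr rfl fun i _ => by ring
  simp only [hexp]
  rw [circleIntegral.integral_fun_sum]
  · simp only [circleIntegral.integral_const_mul, hterm, mul_ite, mul_zero, Finset.sum_ite_eq',
      Finset.mem_range]
    split_ifs with h
    · ring
    · rw [Nat.choose_eq_zero_of_lt (by omega)]
      simp
  · intro i _
    refine ContinuousOn.circleIntegrable hr.le ?_
    exact continuousOn_const.mul (((continuousOn_id.sub continuousOn_const).pow i).mul
      (((continuousOn_id.sub continuousOn_const).pow _).inv₀ fun _ hz =>
        pow_ne_zero _ (sub_ne_zero_of_mem_sphere hw hz)))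

theorem continuousOn_zpow_sphere (hr : 0 < r) (j : ℤ) :
    ContinuousOn (fun z : ℂ => z ^ j) (Metric.sphere 0 r) :=
  continuousOn_id.zpow₀ j fun _ hz => Or.inl (ne_zero_of_mem_sphere hr hz)

theorem continuousOn_derivTwoPoint_sphere (q : ℕ+ × ℂ) (hq : ‖q.2‖ < r) :
    ContinuousOn (fun z : ℂ => derivTwoPoint (1, z) q) (Metric.sphere 0 r) := by
  simp only [derivTwoPoint_one]
  exact continuousOn_const.mul (continuousOn_const.div
    ((continuousOn_id.sub continuousOn_const).pow _) fun _ hz =>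
      pow_ne_zero _ (sub_ne_zero_of_mem_sphere hq hz))

theorem circleIntegral_zpow_neg_mul_derivTwoPoint (hr : 0 < r) (q : ℕ+ × ℂ) (hq : ‖q.2‖ < r)
    (m : ℕ) : (∮ z in C(0, r), z ^ (-(m : ℤ)) * derivTwoPoint (1, z) q) = 0 := by
  have h : ∀ z : ℂ, z ^ (-(m : ℤ)) * derivTwoPoint (1, z) q =
      -(1 / 2) * ((q.1 : ℕ)! : ℂ) * ((z ^ m)⁻¹ * ((z - q.2) ^ ((q.1 : ℕ) + 1))⁻¹) := by
    intro z
    rw [derivTwoPoint_one, zpow_neg, zpow_natCast]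
    ring
  simp only [h, circleIntegral.integral_const_mul]
  rw [circleIntegral_inv_pow_mul hr hq _ m ((q.1 : ℕ) + 1) rfl (by have := q.1.pos; omega)]
  simp

theorem sqrt_two_mul_sqrt_half (m : ℕ+) :
    ((√2 : ℝ) : ℂ) * ((√((m : ℝ) / 2) : ℝ) : ℂ) = ((√(m : ℝ) : ℝ) : ℂ) := by
  rw [← Complex.ofReal_mul, ← Real.sqrt_mul (by norm_num)]
  congr 2
  ring

/-- The residues of the contractions are the amplitudes of the contracted field. -/
theorem circleIntegral_zpow_mul_derivTwoPoint (hr : 0 < r) (q : ℕ+ × ℂ) (hq : ‖q.2‖ < r)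
    (m : ℕ+) : ((√2 : ℝ) : ℂ) / (2 * (Real.pi : ℂ)) *
        (∮ z in C(0, r), z ^ (m : ℤ) * derivTwoPoint (1, z) q) =
      ((√(m : ℝ) : ℝ) : ℂ) * modeAmp q m.natPred := by
  have h1 : (∮ z in C(0, r), z ^ (m : ℤ) * derivTwoPoint (1, z) q) = -(1 / 2) * ((q.1 : ℕ)! : ℂ) *
      (2 * Real.pi * Complex.I * ((m : ℕ).choose q.1 : ℂ) * q.2 ^ ((m : ℕ) - q.1)) := by
    rw [← circleIntegral_pow_mul_inv hr hq, ← circleIntegral.integral_const_mul]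
    congr 1
    funext z
    rw [derivTwoPoint_one, zpow_natCast]
    ring
  have hm : (m : ℕ) = m.natPred + 1 := m.natPred_add_one.symm
  have hl : (q.1 : ℕ) = q.1.natPred + 1 := q.1.natPred_add_one.symm
  have hd : ((q.1 : ℕ)! : ℂ) * ((m : ℕ).choose q.1 : ℂ) =
      (m : ℕ) * (m.natPred.descFactorial q.1.natPred : ℂ) := by
    have := Nat.succ_descFactorial_succ m.natPred q.1.natPred
    rw [← Nat.succ_eq_add_one, ← Nat.succ_eq_add_one] at this
    have e := Nat.descFactorial_eq_factorial_mul_choose (m : ℕ) q.1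
    rw [← Nat.cast_mul, ← e, ← Nat.cast_mul]
    congr 1
    conv_lhs => rw [hm, hl]
    rw [hm]
    exact this
  have he : (m : ℕ) - (q.1 : ℕ) = m.natPred - q.1.natPred := by omega
  have hs2 : ((√((m : ℝ) / 2) : ℝ) : ℂ) * ((√((m : ℝ) / 2) : ℝ) : ℂ) = (m : ℕ) / 2 := by
    rw [← Complex.ofReal_mul, Real.mul_self_sqrt (by positivity)]
    simp
  have hmr : ((m.natPred : ℝ) + 1) = m := by exact_mod_cast m.natPred_add_one
  have hpi : (Real.pi : ℂ) ≠ 0 := by exact_mod_cast Real.pi_ne_zero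
  rw [h1, modeAmp, he, hmr, ← sqrt_two_mul_sqrt_half]
  calc _ = ((√2 : ℝ) : ℂ) / (2 * (Real.pi : ℂ)) * (-(1 / 2) * (2 * Real.pi * Complex.I) *
        (((q.1 : ℕ)! : ℂ) * ((m : ℕ).choose q.1 : ℂ)) * q.2 ^ (m.natPred - q.1.natPred)) := by ring
    _ = -Complex.I * ((√2 : ℝ) : ℂ) * ((m : ℕ) / 2) *
        (m.natPred.descFactorial q.1.natPred : ℂ) * q.2 ^ (m.natPred - q.1.natPred) := by
      rw [hd]
      field_simp
    _ = _ := by rw [← hs2]; ring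

theorem circleIntegral_zpow_mul_modeAmp (hr : 0 < r) (j : ℤ) (m : ℕ+) :
    ((√2 : ℝ) : ℂ) / (2 * (Real.pi : ℂ)) *
        (∮ z in C(0, r), z ^ j * modeAmp (1, z) m.natPred) =
      if j = -(m : ℤ) then ((√(m : ℝ) : ℝ) : ℂ) else 0 := by
  have hmr : ((m.natPred : ℝ) + 1) = m := by exact_mod_cast m.natPred_add_one
  have h : (∮ z in C(0, r), z ^ j * modeAmp (1, z) m.natPred) =
      -Complex.I * ((√((m : ℝ) / 2) : ℝ) : ℂ) * ∮ z in C(0, r), (z - 0) ^ (j + m.natPred) := by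
    rw [← circleIntegral.integral_const_mul]
    refine circleIntegral.integral_congr hr.le fun z hz => ?_
    rw [modeAmp_one, sub_zero, zpow_add₀ (ne_zero_of_mem_sphere hr hz), zpow_natCast, hmr]
    ring
  have hm : (m : ℤ) = m.natPred + 1 := by exact_mod_cast m.natPred_add_one.symm
  rw [h]
  split_ifs with hj
  · have e : j + m.natPred = -1 := by omega
    have hpi : (Real.pi : ℂ) ≠ 0 := by exact_mod_cast Real.pi_ne_zero
    simp only [e, zpow_neg_one]
    rw [circleIntegral.integral_sub_inv_of_mem_ball (by simpa), ← sqrt_two_mul_sqrt_half]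
    field_simp
    rw [Complex.I_sq]
    ring
  · rw [circleIntegral.integral_sub_zpow_of_ne (by omega)]
    simp

theorem circleIntegral_list_sum {ι : Type*} (l : List ι) (f : ι → ℂ → ℂ)
    (h : ∀ i ∈ l, CircleIntegrable (f i) 0 r) :
    CircleIntegrable (fun z => (l.map fun i => f i z).sum) 0 r ∧
      (∮ z in C(0, r), (l.map fun i => f i z).sum) =
        (l.map fun i => ∮ z in C(0, r), f i z).sum := by
  induction l with
  | nil => exact ⟨by simp, by simp [circleIntegral]⟩
  | cons a l ih =>
    have ih := ih fun i hi => h i (List.mem_cons_of_mem _ hi)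
    simp only [List.map_cons, List.sum_cons]
    exact ⟨(h a (by simp)).add ih.1, by rw [circleIntegral.integral_add (h a (by simp)) ih.1, ih.2]⟩

end Contour

/-! ### Modes of the field on Fock space -/

/-- `√m` times the annihilation operator of the mode `m`, on all functions of the occupation
numbers. -/
def lowerFun (m : ℕ+) : ((ℕ+ →₀ ℕ) → ℂ) →ₗ[ℂ] ((ℕ+ →₀ ℕ) → ℂ) where
  toFun x n := ((√((m : ℝ) * (n m + 1)) : ℝ) : ℂ) * x (n + Finsupp.single m 1)
  map_add' _ _ := funext fun _ => mul_add _ _ _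
  map_smul' _ _ := funext fun _ => mul_left_comm _ _ _

/-- `√m` times the creation operator of the mode `m`, on all functions of the occupation
numbers. -/
def raiseFun (m : ℕ+) : ((ℕ+ →₀ ℕ) → ℂ) →ₗ[ℂ] ((ℕ+ →₀ ℕ) → ℂ) where
  toFun x n := ((√((m : ℝ) * n m) : ℝ) : ℂ) * x (n - Finsupp.single m 1)
  map_add' _ _ := funext fun _ => mul_add _ _ _
  map_smul' _ _ := funext fun _ => mul_left_comm _ _ _

/-- The mode `j` of the field on functions of the occupation numbers: annihilation for positive,
creation for negative `j`, and `0` for `j = 0`. -/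
def modeFun : ℤ → ((ℕ+ →₀ ℕ) → ℂ) →ₗ[ℂ] ((ℕ+ →₀ ℕ) → ℂ)
  | .ofNat 0 => 0
  | .ofNat (k + 1) => lowerFun k.succPNat
  | .negSucc k => raiseFun k.succPNat

theorem int_cases_pnat (j : ℤ) : j = 0 ∨ (∃ m : ℕ+, j = m) ∨ ∃ m : ℕ+, j = -(m : ℤ) := by
  rcases j with (_ | k) | k
  · exact Or.inl rfl
  · exact Or.inr (Or.inl ⟨k.succPNat, rfl⟩)
  · exact Or.inr (Or.inr ⟨k.succPNat, rfl⟩)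

theorem modeFun_zero : modeFun 0 = 0 := rfl

theorem modeFun_coe (m : ℕ+) : modeFun (m : ℤ) = lowerFun m := by
  obtain ⟨k, rfl⟩ : ∃ k, m = Nat.succPNat k := ⟨m.natPred, m.succPNat_natPred.symm⟩
  rfl

theorem modeFun_neg (m : ℕ+) : modeFun (-(m : ℤ)) = raiseFun m := by
  obtain ⟨k, rfl⟩ : ∃ k, m = Nat.succPNat k := ⟨m.natPred, m.succPNat_natPred.symm⟩
  rfl

section MovingField

variable {β : Type*} {c : β → β → ℂ} {g : β → ℕ+ × ℂ} {a : ℂ → β} {κ : ℂ} {L : List β} {r : ℝ}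

/-- The data of a product of a field `a z = ∂X(z)`, with `z` moving on the circle of radius `r`,
with fields `b ∈ L` enclosed by the circle. The contractions of `a z` with the fields in `L` are the
two-point functions times a constant `κ`, which is `0` for a Wick product and `1` for a product. -/
structure IsMovingField (c : β → β → ℂ) (g : β → ℕ+ × ℂ) (a : ℂ → β) (κ : ℂ) (L : List β)
    (r : ℝ) : Prop where
  radius_pos : 0 < r
  radius_lt : r < 1
  field_eq : ∀ z, g (a z) = (1, z)
  left : ∀ z, ∀ b ∈ L, c (a z) b = κ * derivTwoPoint (1, z) (g b)
  right : ∀ z, ∀ b ∈ L, c b (a z) = κ * derivTwoPoint (1, z) (g b)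
  self : ∀ z, c (a z) (a z) = 0
  encloses : ∀ b ∈ L, ‖(g b).2‖ < r

theorem tendsto_modeInner_modeAmp {u v : ℕ → ℂ} {z w : ℂ} (hu : Tendsto u atTop (𝓝 z))
    (hv : Tendsto v atTop (𝓝 w)) (hu1 : ∀ i, ‖u i‖ < 1) (hv1 : ∀ i, ‖v i‖ < 1) (hz : ‖z‖ < 1)
    (hw : ‖w‖ < 1) (l : ℕ+) :
    Tendsto (fun i => modeInner (modeAmp (1, u i)) (modeAmp (l, v i))) atTop
      (𝓝 (modeInner (modeAmp (1, z)) (modeAmp (l, w)))) := by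
  simp only [fun i => modeInner_modeAmp (hu1 i) l (hv1 i), modeInner_modeAmp hz l hw]
  have hc := (Complex.continuous_conj.tendsto z).comp hu
  exact ((hc.pow _).const_mul _).div ((tendsto_const_nhds.sub (hc.mul hv)).pow _)
    (pow_ne_zero _ (one_sub_conj_mul_ne_zero hz hw))

theorem conj_modeInner (x y : ℕ → ℂ) : conj (modeInner x y) = modeInner y x := by
  rw [modeInner, Complex.conj_tsum, modeInner]
  simp [mul_comm]

theorem IsMovingField.sqSummable (h : IsMovingField c g a κ L r) {b : β} (hb : b ∈ L) :
    SqSummable (modeAmp (g b)) :=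
  sqSummable_modeAmp ((h.encloses b hb).trans h.radius_lt)

theorem IsMovingField.sqSummable_cons (h : IsMovingField c g a κ L r) {z : ℂ}
    (hz : z ∈ Metric.sphere (0 : ℂ) r) : ∀ b ∈ a z :: L, SqSummable (modeAmp (g b)) := by
  intro b hb
  rcases List.mem_cons.1 hb with rfl | hb
  · refine sqSummable_modeAmp ?_
    rw [h.field_eq]
    simpa [mem_sphere_zero_iff_norm.1 hz] using h.radius_lt
  · exact h.sqSummable hb

theorem IsMovingField.continuousOn (h : IsMovingField c g a κ L r) :
    ContinuousOn (fun z => wickVec c (fun b => modeAmp (g b)) (a z :: L)) (Metric.sphere 0 r) := by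
  rw [continuousOn_iff_continuous_domRestrict]
  refine SeqContinuous.continuous fun u z hu => ?_
  have hu' : Tendsto (fun i => (u i : ℂ)) atTop (𝓝 z) :=
    (continuous_subtype_val.tendsto z).comp hu
  have hn : ∀ y : Metric.sphere (0 : ℂ) r, ‖(y : ℂ)‖ < 1 := fun y => by
    rw [mem_sphere_zero_iff_norm.1 y.2]; exact h.radius_lt
  let G : ℂ → Option β → β := fun y o => o.elim (a y) id
  have hG : ∀ y, a y :: L = (none :: L.map some).map (G y) := fun y => by
    simp [G, Function.comp_def]
  have hmem : ∀ o ∈ none :: L.map some, o = none ∨ ∃ b ∈ L, o = some b := by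
    intro o ho
    simp only [List.mem_cons, List.mem_map] at ho
    rcases ho with rfl | ⟨b, hb, rfl⟩
    · exact Or.inl rfl
    · exact Or.inr ⟨b, hb, rfl⟩
  simp only [Function.comp_def, Set.domRestrict_apply]
  have hval : ∀ y : ℂ, wickVec c (fun b => modeAmp (g b)) (a y :: L) =
      wickVec (fun s t => c (G y s) (G y t)) (fun s => modeAmp (g (G y s)))
        (none :: L.map some) := fun y => by rw [hG, wickVec_map]
  have hsum : ∀ y ∈ Metric.sphere (0 : ℂ) r, ∀ o ∈ none :: L.map some,
      SqSummable (modeAmp (g (G y o))) := by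
    intro y hy o ho
    refine h.sqSummable_cons hy _ ?_
    rw [hG]
    exact List.mem_map_of_mem ho
  have hL1 : ∀ b ∈ L, ‖(g b).2‖ < 1 := fun b hb => (h.encloses b hb).trans h.radius_lt
  have key : ∀ v : ℕ → Metric.sphere (0 : ℂ) r, Tendsto (fun i => (v i : ℂ)) atTop (𝓝 z) →
      ∀ s ∈ none :: L.map some, ∀ t ∈ none :: L.map some,
        Tendsto (fun i => modeInner (modeAmp (g (G (u i) s))) (modeAmp (g (G (v i) t)))) atTop
          (𝓝 (modeInner (modeAmp (g (G z s))) (modeAmp (g (G z t))))) := by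
    intro v hv s hs t ht
    rcases hmem s hs with rfl | ⟨b, hb, rfl⟩ <;> rcases hmem t ht with rfl | ⟨b', hb', rfl⟩ <;>
      simp only [G, Option.elim_none, Option.elim_some, h.field_eq, id]
    · exact tendsto_modeInner_modeAmp hu' hv (fun i => hn _) (fun i => hn _) (hn z) (hn z) 1
    · exact tendsto_modeInner_modeAmp hu' tendsto_const_nhds (fun i => hn _)
        (fun _ => hL1 b' hb') (hn z) (hL1 b' hb') (g b').1
    · simp only [← conj_modeInner (modeAmp (1, _)) (modeAmp (g b))]
      exact (Complex.continuous_conj.tendsto _).comp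
        (tendsto_modeInner_modeAmp hv tendsto_const_nhds (fun i => hn _) (fun _ => hL1 b hb)
          (hn z) (hL1 b hb) (g b).1)
    · exact tendsto_const_nhds
  have hD : ∀ b ∈ L, Tendsto (fun i => κ * derivTwoPoint (1, (u i : ℂ)) (g b)) atTop
      (𝓝 (κ * derivTwoPoint (1, (z : ℂ)) (g b))) := by
    intro b hb
    refine Tendsto.const_mul κ ?_
    have := (continuousOn_derivTwoPoint_sphere (g b) (h.encloses b hb)).domRestrict.tendsto z
    exact this.comp hu
  simp only [hval]
  refine tendsto_wickVec_of_tendsto (fun i => hsum _ (u i).2) (hsum _ z.2) ?_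
    (key u hu') (key (fun _ => z) tendsto_const_nhds)
  intro s hs t ht
  rcases hmem s hs with rfl | ⟨b, hb, rfl⟩ <;> rcases hmem t ht with rfl | ⟨b', hb', rfl⟩ <;>
    simp only [G, Option.elim_none, Option.elim_some, id, h.self]
  · exact tendsto_const_nhds
  · simp only [h.left _ b' hb']
    exact hD b' hb'
  · simp only [h.right _ b hb]
    exact hD b hb
  · exact tendsto_const_nhds

theorem IsMovingField.circleIntegrable (h : IsMovingField c g a κ L r) (j : ℤ) :
    CircleIntegrable (fun z => z ^ j • wickVec c (fun b => modeAmp (g b)) (a z :: L)) 0 r :=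
  ((continuousOn_zpow_sphere h.radius_pos j).smul h.continuousOn).circleIntegrable h.radius_pos.le

theorem IsMovingField.circleIntegral_apply (h : IsMovingField c g a κ L r) (j : ℤ)
    (n : ℕ+ →₀ ℕ) :
    (∮ z in C(0, r), z ^ j * wickVec c (fun b => modeAmp (g b)) (a z :: L) n) =
      ∑ m ∈ n.support, (∮ z in C(0, r), z ^ j * modeAmp (1, z) m.natPred) * (((√(n m) : ℝ) : ℂ) *
        wickVec c (fun b => modeAmp (g b)) L (n - Finsupp.single m 1)) +
      ((picks L).map fun p => κ * (∮ z in C(0, r), z ^ j * derivTwoPoint (1, z) (g p.1)) *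
        wickVec c (fun b => modeAmp (g b)) p.2 n).sum := by
  have hr := h.radius_pos
  set V := wickVec c fun b => modeAmp (g b)
  have e : (∮ z in C(0, r), z ^ j * V (a z :: L) n) = ∮ z in C(0, r),
      (∑ m ∈ n.support, (((√(n m) : ℝ) : ℂ) * V L (n - Finsupp.single m 1)) *
        (z ^ j * modeAmp (1, z) m.natPred) +
      ((picks L).map fun p => (κ * V p.2 n) * (z ^ j * derivTwoPoint (1, z) (g p.1))).sum) := by
    refine circleIntegral.integral_congr hr.le fun z hz => ?_
    simp only [V]
    rw [wickVec_cons_apply c (h.sqSummable_cons hz) n, mul_add, Finset.mul_sum,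
      ← List.sum_map_mul_left, h.field_eq]
    congr 1
    · exact Finset.sum_congr rfl fun m _ => by ring
    · congr 1
      refine List.map_congr_left fun p hp => ?_
      rw [h.left z p.1 (mem_of_mem_picks hp).1]
      ring
  have h1 : ∀ m ∈ n.support, CircleIntegrable (fun z =>
      (((√(n m) : ℝ) : ℂ) * V L (n - Finsupp.single m 1)) *
        (z ^ j * modeAmp (1, z) m.natPred)) 0 r := by
    intro m _
    refine ContinuousOn.circleIntegrable hr.le (continuousOn_const.mul
      ((continuousOn_zpow_sphere hr j).mul ?_))
    simp only [modeAmp_one]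
    fun_prop
  have h2 : ∀ p ∈ picks L, CircleIntegrable (fun z =>
      (κ * V p.2 n) * (z ^ j * derivTwoPoint (1, z) (g p.1))) 0 r := by
    intro p hp
    exact ContinuousOn.circleIntegrable hr.le (continuousOn_const.mul
      ((continuousOn_zpow_sphere hr j).mul
        (continuousOn_derivTwoPoint_sphere _ (h.encloses _ (mem_of_mem_picks hp).1))))
  have h3 := circleIntegral_list_sum _ _ h2
  rw [e, circleIntegral.integral_add (CircleIntegrable.fun_sum _ h1) h3.1, h3.2,
    circleIntegral.integral_fun_sum h1]
  simp only [circleIntegral.integral_const_mul]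
  congr 1
  · exact Finset.sum_congr rfl fun m _ => by ring
  · congr 1
    exact List.map_congr_left fun p _ => by ring

/-- The contour integrals of the moving field act on the other fields by the modes. A Wick product
with the moving field gives the creation operators only. -/
theorem IsMovingField.modeFun_eq (h : IsMovingField c g a κ L r) (j : ℤ) (hκ : κ = 1 ∨ j < 0)
    (n : ℕ+ →₀ ℕ) :
    ((√2 : ℝ) : ℂ) / (2 * (Real.pi : ℂ)) *
        (∮ z in C(0, r), z ^ j * wickVec c (fun b => modeAmp (g b)) (a z :: L) n) =
      modeFun j (wickVec c (fun b => modeAmp (g b)) L) n := by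
  have hr := h.radius_pos
  set C₀ := ((√2 : ℝ) : ℂ) / (2 * (Real.pi : ℂ)) with hC
  set V := wickVec c fun b => modeAmp (g b)
  have hexp : C₀ * (∮ z in C(0, r), z ^ j * V (a z :: L) n) =
      ∑ m ∈ n.support, (if j = -(m : ℤ) then ((√(m : ℝ) : ℝ) : ℂ) else 0) *
        (((√(n m) : ℝ) : ℂ) * V L (n - Finsupp.single m 1)) +
      ((picks L).map fun p => κ * (C₀ * ∮ z in C(0, r), z ^ j * derivTwoPoint (1, z) (g p.1)) *
        V p.2 n).sum := by
    rw [h.circleIntegral_apply, mul_add, Finset.mul_sum, ← List.sum_map_mul_left]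
    congr 1
    · refine Finset.sum_congr rfl fun m _ => ?_
      rw [← circleIntegral_zpow_mul_modeAmp hr]
      ring
    · congr 1
      exact List.map_congr_left fun p _ => by ring
  have hcontr : ∀ m : ℕ, ∀ p ∈ picks L,
      (∮ z in C(0, r), z ^ (-(m : ℤ)) * derivTwoPoint (1, z) (g p.1)) = 0 := fun m p hp =>
    circleIntegral_zpow_neg_mul_derivTwoPoint hr _ (h.encloses _ (mem_of_mem_picks hp).1) m
  rw [hexp]
  rcases int_cases_pnat j with rfl | ⟨m, rfl⟩ | ⟨m, rfl⟩
  · have h0 : ((picks L).map fun p => κ * (C₀ * ∮ z in C(0, r), z ^ (0 : ℤ) *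
        derivTwoPoint (1, z) (g p.1)) * V p.2 n) = (picks L).map fun _ => 0 :=
      List.map_congr_left fun p hp => by
        have := hcontr 0 p hp
        rw [Nat.cast_zero, neg_zero] at this
        rw [this, mul_zero, mul_zero, zero_mul]
    rw [h0, modeFun_zero, Finset.sum_eq_zero]
    · simp
    · intro m _
      have : ¬ (0 : ℤ) = -(m : ℤ) := by have := m.pos; omega
      simp [this]
  · have hκ1 : κ = 1 := hκ.resolve_right (by have := m.pos; omega)
    subst hκ1
    have h0 : ((picks L).map fun p => (1 : ℂ) * (C₀ * ∮ z in C(0, r), z ^ (m : ℤ) *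
        derivTwoPoint (1, z) (g p.1)) * V p.2 n) = (picks L).map fun p =>
          ((√(m : ℝ) : ℝ) : ℂ) * (modeAmp (g p.1) m.natPred * V p.2 n) :=
      List.map_congr_left fun p hp => by
        rw [hC, circleIntegral_zpow_mul_derivTwoPoint hr _ (h.encloses _ (mem_of_mem_picks hp).1)]
        ring
    rw [h0, List.sum_map_mul_left, modeFun_coe, Finset.sum_eq_zero]
    · rw [← wickVec_add_single c (fun b hb => h.sqSummable hb), zero_add]
      simp only [lowerFun, LinearMap.coe_mk, AddHom.coe_mk, V]
      rw [Real.sqrt_mul (by positivity), Complex.ofReal_mul, mul_assoc]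
    · intro m' _
      have : ¬ (m : ℤ) = -(m' : ℤ) := by have := m.pos; have := m'.pos; omega
      simp [this]
  · have h0 : ((picks L).map fun p => κ * (C₀ * ∮ z in C(0, r), z ^ (-(m : ℤ)) *
        derivTwoPoint (1, z) (g p.1)) * V p.2 n) = (picks L).map fun _ => 0 :=
      List.map_congr_left fun p hp => by rw [hcontr m p hp, mul_zero, mul_zero, zero_mul]
    rw [h0, modeFun_neg, Finset.sum_eq_single m]
    · simp only [if_true, raiseFun, LinearMap.coe_mk, AddHom.coe_mk]
      rw [Real.sqrt_mul (by positivity), Complex.ofReal_mul]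
      simp [mul_assoc]
    · intro m' _ hm'
      have : ¬ (-(m : ℤ)) = -(m' : ℤ) := by
        intro h'
        exact hm' (PNat.coe_injective (by omega))
      simp [this]
    · intro hm
      have : n m = 0 := by simpa using hm
      simp [this]

end MovingField

/-! ### Vectors of single Wick products -/

/-- The vector of a single Wick product. -/
def pureVec (L : List (ℕ+ × ℂ)) : FockSpace := wickVec (fun _ _ => 0) modeAmp L

theorem wickPoly_zero {β : Type*} (e : β → MvPolynomial ℕ ℂ) (L : List β) :
    wickPoly (fun _ _ => 0) e L = (L.map e).prod := by
  induction L with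
  | nil => simp [wickPoly]
  | cons a L ih => rw [wickPoly_cons, ih]; simp

theorem pureVec_perm {L M : List (ℕ+ × ℂ)} (h : L.Perm M) : pureVec L = pureVec M := by
  simp only [pureVec, wickVec, wickPoly_zero]
  congr 1
  funext N
  rw [(h.map _).prod_eq]

theorem pureVec_nil : pureVec [] = lp.single 2 (0 : ℕ+ →₀ ℕ) (1 : ℂ) := wickVec_nil _ _

theorem wickVec_zero_legs (M : List (ℕ × ℕ+ × ℂ)) :
    wickVec (fun _ _ => 0) (fun a => modeAmp a.2) M = pureVec (M.map Prod.snd) :=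
  (wickVec_map (fun _ _ => 0) modeAmp Prod.snd M).symm

theorem symbolVec_of (Z : WickSymbol) : symbolVec (FreeMonoid.of Z) = pureVec Z.1 := by
  rw [symbolVec, legs_of, wickVec_map]
  simp only [legWeight, if_true]
  rfl

theorem symbolVec_one : symbolVec 1 = pureVec [] := by
  rw [symbolVec, pureVec_nil]
  exact wickVec_nil _ _

theorem wickVec_shift_legs (k : ℕ) (w : FreeMonoid WickSymbol) :
    wickVec legWeight (fun a => modeAmp a.2) ((legs w).map fun a => (k + a.1, a.2)) =
      symbolVec w := by
  rw [wickVec_map, symbolVec]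
  congr 1
  funext a b
  simp [legWeight]

theorem symbolVec_field_mul (z : ℂ) (w : FreeMonoid WickSymbol) :
    symbolVec (FreeMonoid.of (field 1 z) * w) = wickVec legWeight (fun a => modeAmp a.2)
      ((0, 1, z) :: (legs w).map fun a => (1 + a.1, a.2)) := by
  rw [symbolVec, legs_mul, legs_of]
  rfl

theorem isMovingField_symbol {r : ℝ} (hr : 0 < r) (hr1 : r < 1) {w : FreeMonoid WickSymbol}
    (hw : ∀ Z ∈ w.toList, ∀ p ∈ Z.1, ‖p.2‖ < r) :
    IsMovingField legWeight Prod.snd (fun z => (0, 1, z)) 1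
      ((legs w).map fun a => (1 + a.1, a.2)) r where
  radius_pos := hr
  radius_lt := hr1
  field_eq _ := rfl
  left z b hb := by
    obtain ⟨a, -, rfl⟩ := List.mem_map.1 hb
    have : ¬ 0 = 1 + a.1 := by omega
    simp [legWeight, this]
  right z b hb := by
    obtain ⟨a, -, rfl⟩ := List.mem_map.1 hb
    simp [legWeight, derivTwoPoint_comm a.2]
  self z := by simp [legWeight]
  encloses b hb := by
    obtain ⟨a, ha, rfl⟩ := List.mem_map.1 hb
    obtain ⟨-, Z, hZ, h⟩ := exists_of_mem_legs ha
    exact hw Z hZ _ h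

theorem isMovingField_pure {r : ℝ} (hr : 0 < r) (hr1 : r < 1) {L : List (ℕ+ × ℂ)}
    (hL : ∀ p ∈ L, ‖p.2‖ < r) :
    IsMovingField (fun _ _ => 0) (fun p : ℕ+ × ℂ => p) (fun z => (1, z)) 0 L r where
  radius_pos := hr
  radius_lt := hr1
  field_eq _ := rfl
  left z b hb := by simp
  right z b hb := by simp
  self z := rfl
  encloses := hL

/-- The field `∂ᵐX(0)` creates a particle of mode `m`. -/
theorem pureVec_zero_cons_apply (m : ℕ+) {L : List (ℕ+ × ℂ)} (hL : ∀ p ∈ L, ‖p.2‖ < 1)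
    (n : ℕ+ →₀ ℕ) : pureVec ((m, 0) :: L) n = modeAmp (m, 0) m.natPred *
      (((√(n m) : ℝ) : ℂ) * pureVec L (n - Finsupp.single m 1)) := by
  have h : ∀ p ∈ (m, 0) :: L, SqSummable (modeAmp p) := by
    intro p hp
    refine sqSummable_modeAmp ?_
    rcases List.mem_cons.1 hp with rfl | hp
    · simp
    · exact hL p hp
  rw [pureVec, wickVec_cons_apply _ h, Finset.sum_eq_single m]
  · simp [pureVec]
  · intro m' _ hm'
    rw [modeAmp_zero m fun h => hm' (PNat.natPred_injective h), zero_mul]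
  · intro hm
    have : n m = 0 := by simpa using hm
    simp [this]

theorem modeConst_mul_modeAmp (m : ℕ+) :
    ((√2 : ℝ) : ℂ) * Complex.I / (((m : ℕ) - 1)! : ℂ) * modeAmp (m, 0) m.natPred =
      ((√(m : ℝ) : ℝ) : ℂ) := by
  have hf : (((m : ℕ) - 1)! : ℂ) ≠ 0 := by exact_mod_cast Nat.factorial_ne_zero _
  rw [modeAmp_zero_self, ← sqrt_two_mul_sqrt_half]
  field_simp
  rw [Complex.I_sq]
  ring

theorem modeAmp_zero_self_ne_zero (m : ℕ+) : modeAmp (m, 0) m.natPred ≠ 0 := by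
  intro h
  have := modeConst_mul_modeAmp m
  rw [h, mul_zero] at this
  have hm : (√(m : ℝ)) ≠ 0 := Real.sqrt_ne_zero'.2 (by exact_mod_cast m.pos)
  exact hm (by exact_mod_cast this.symm)

theorem raiseFun_pureVec (m : ℕ+) {L : List (ℕ+ × ℂ)} (hL : ∀ p ∈ L, ‖p.2‖ < 1) :
    ⇑((((√2 : ℝ) : ℂ) * Complex.I / (((m : ℕ) - 1)! : ℂ)) • pureVec ((m, 0) :: L)) =
      raiseFun m (pureVec L) := by
  funext n
  rw [lp.coeFn_smul, Pi.smul_apply, pureVec_zero_cons_apply m hL, smul_eq_mul, ← mul_assoc,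
    modeConst_mul_modeAmp]
  simp only [raiseFun, LinearMap.coe_mk, AddHom.coe_mk]
  rw [Real.sqrt_mul (by positivity), Complex.ofReal_mul, mul_assoc]

theorem lowerFun_pureVec (m : ℕ+) {L : List (ℕ+ × ℂ)} (hL : ∀ p ∈ L, ‖p.2‖ < 1) :
    ⇑(((√(m : ℝ) : ℝ) : ℂ) •
      ((picks L).map fun p => modeAmp p.1 m.natPred • pureVec p.2).sum) =
      lowerFun m (pureVec L) := by
  funext n
  have h := wickVec_add_single (fun _ _ => 0) (fun p hp => sqSummable_modeAmp (hL p hp)) m n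
  rw [lp.coeFn_smul, Pi.smul_apply, list_sum_fock_apply]
  simp only [lowerFun, LinearMap.coe_mk, AddHom.coe_mk]
  rw [Real.sqrt_mul (by positivity), Complex.ofReal_mul, mul_assoc, pureVec, h]
  rfl

/-- The span of the vectors of Wick products with points in the unit disc. -/
def discVectors : Submodule ℂ FockSpace :=
  Submodule.span ℂ (pureVec '' {L | ∀ p ∈ L, ‖p.2‖ < 1})

theorem pureVec_mem {L : List (ℕ+ × ℂ)} (hL : ∀ p ∈ L, ‖p.2‖ < 1) : pureVec L ∈ discVectors :=
  Submodule.subset_span ⟨L, hL, rfl⟩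

theorem list_sum_mem_discVectors {ι : Type*} (l : List ι) (v : ι → FockSpace)
    (h : ∀ i ∈ l, v i ∈ discVectors) : (l.map v).sum ∈ discVectors :=
  list_sum_mem fun x hx => by
    obtain ⟨i, hi, rfl⟩ := List.mem_map.1 hx
    exact h i hi

/-- The modes preserve the span of the vectors of Wick products. -/
theorem exists_modeFun_eq (j : ℤ) {v : FockSpace} (hv : v ∈ discVectors) :
    ∃ u ∈ discVectors, ⇑u = modeFun j v := by
  induction hv using Submodule.span_induction with
  | mem v hv =>
    obtain ⟨L, hL, rfl⟩ := hv
    rcases int_cases_pnat j with rfl | ⟨m, rfl⟩ | ⟨m, rfl⟩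
    · exact ⟨0, zero_mem _, by rw [modeFun_zero]; rfl⟩
    · refine ⟨_, ?_, by rw [modeFun_coe]; exact lowerFun_pureVec m hL⟩
      refine Submodule.smul_mem _ _ (list_sum_mem_discVectors _ _ fun p hp => ?_)
      exact Submodule.smul_mem _ _
        (pureVec_mem fun q hq => hL q ((mem_of_mem_picks hp).2 q hq))
    · refine ⟨_, ?_, by rw [modeFun_neg]; exact raiseFun_pureVec m hL⟩
      refine Submodule.smul_mem _ _ (pureVec_mem fun q hq => ?_)
      rcases List.mem_cons.1 hq with rfl | hq
      · simp
      · exact hL q hq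
  | zero => exact ⟨0, zero_mem _, by rw [lp.coeFn_zero, map_zero]⟩
  | add v w _ _ hv hw =>
    obtain ⟨u₁, h1, h1'⟩ := hv
    obtain ⟨u₂, h2, h2'⟩ := hw
    exact ⟨u₁ + u₂, add_mem h1 h2, by rw [lp.coeFn_add, lp.coeFn_add, map_add, h1', h2']⟩
  | smul a v _ hv =>
    obtain ⟨u, h, h'⟩ := hv
    exact ⟨a • u, Submodule.smul_mem _ _ h, by rw [lp.coeFn_smul, lp.coeFn_smul, map_smul, h']⟩

theorem symbolVec_mem {w : FreeMonoid WickSymbol} (hw : InDisc w) :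
    symbolVec w ∈ discVectors := by
  obtain ⟨T, hT, h⟩ := exists_wickVec_eq legWeight (legs w)
  have hsub : ∀ M : List (ℕ × ℕ+ × ℂ), M.Sublist (legs w) →
      wickVec (fun _ _ => 0) (fun a => modeAmp a.2) M ∈ discVectors := by
    intro M hM
    rw [wickVec_zero_legs]
    refine pureVec_mem fun p hp => ?_
    obtain ⟨a, ha, rfl⟩ := List.mem_map.1 hp
    exact hw.norm_lt_one (hM.subset ha)
  rw [symbolVec, h _ fun a ha => sqSummable_modeAmp (hw.norm_lt_one ha)]
  exact add_mem (hsub _ (List.Sublist.refl _))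
    (list_sum_mem_discVectors _ _ fun t ht => Submodule.smul_mem _ _ (hsub _ (hT t ht).1))

/-! ### Totality of the vectors of products of fields -/

theorem clm_circleIntegral {E F : Type*} [NormedAddCommGroup E] [NormedSpace ℂ E]
    [CompleteSpace E] [NormedAddCommGroup F] [NormedSpace ℂ F] [CompleteSpace F] (T : E →L[ℂ] F)
    {f : ℂ → E} {r : ℝ} (hf : CircleIntegrable f 0 r) :
    T (∮ z in C(0, r), f z) = ∮ z in C(0, r), T (f z) := by
  rw [circleIntegral, circleIntegral, ← ContinuousLinearMap.intervalIntegral_comp_comm _ hf.out]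
  simp

theorem circleIntegral_fock_apply {f : ℂ → FockSpace} {r : ℝ} (hf : CircleIntegrable f 0 r)
    (n : ℕ+ →₀ ℕ) : (∮ z in C(0, r), f z) n = ∮ z in C(0, r), f z n :=
  clm_circleIntegral (lp.evalCLM ℂ (fun _ : ℕ+ →₀ ℕ => ℂ) 2 n) hf

theorem exists_radius (Z : List ℂ) (hZ : ∀ z ∈ Z, ‖z‖ < 1) :
    ∃ r : ℝ, 0 < r ∧ r < 1 ∧ ∀ z ∈ Z, ‖z‖ < r := by
  induction Z with
  | nil => exact ⟨1 / 2, by norm_num, by norm_num, by simp⟩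
  | cons z Z ih =>
    obtain ⟨r, h0, h1, h⟩ := ih fun w hw => hZ w (List.mem_cons_of_mem _ hw)
    obtain ⟨s, hs, hs1⟩ := exists_between (max_lt h1 (hZ z (by simp)))
    refine ⟨s, h0.trans (lt_of_le_of_lt (le_max_left _ _) hs), hs1, fun w hw => ?_⟩
    rcases List.mem_cons.1 hw with rfl | hw
    · exact lt_of_le_of_lt (le_max_right _ _) hs
    · exact (h w hw).trans (lt_of_le_of_lt (le_max_left _ _) hs)

/-- The vectors of products of fields at distinct points span those of the Wick products of the
same fields. -/
theorem inner_pureVec_eq_zero {x : FockSpace}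
    (hx : ∀ Z ∈ discSymbols, inner ℂ x (symbolVec (FreeMonoid.map (field 1) Z)) = 0) (k : ℕ) :
    ∀ Z : FreeMonoid ℂ, Z ∈ discSymbols → Z.toList.length = k →
      inner ℂ x (pureVec (Z.toList.map fun z => (1, z))) = 0 := by
  induction k using Nat.strong_induction_on with
  | _ k ih =>
  intro Z hZ hk
  have hlegs := legs_map_field Z
  obtain ⟨T, hT, h⟩ := exists_wickVec_eq legWeight (legs (FreeMonoid.map (field 1) Z))
  have h2 : (legs (FreeMonoid.map (field 1) Z)).map (fun a => a.2.2) = Z.toList := by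
    rw [hlegs, List.map_map]
    exact List.zipIdx_map_fst 0 Z.toList
  have h3 : ∀ M : List (ℕ × ℕ+ × ℂ), M.Sublist (legs (FreeMonoid.map (field 1) Z)) →
      M.map Prod.snd = (M.map fun a => a.2.2).map fun z => (1, z) := by
    intro M hM
    rw [List.map_map]
    refine List.map_congr_left fun a ha => ?_
    have := hM.subset ha
    rw [hlegs, List.mem_map] at this
    obtain ⟨p, -, rfl⟩ := this
    rfl
  have h4 := hx Z hZ
  rw [symbolVec, h _ fun a ha => sqSummable_modeAmp ((inDisc_map_field hZ).norm_lt_one ha),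
    inner_add_right, wickVec_zero_legs, h3 _ (List.Sublist.refl _), h2] at h4
  have h5 : inner ℂ x (T.map fun t => t.1 • wickVec (fun _ _ => 0)
      (fun a : ℕ × ℕ+ × ℂ => modeAmp a.2) t.2).sum = 0 := by
    change innerSL ℂ x _ = 0
    rw [map_list_sum, List.map_map]
    refine List.sum_eq_zero fun y hy => ?_
    obtain ⟨t, ht, rfl⟩ := List.mem_map.1 hy
    have hsub := (hT t ht).1.map (fun a : ℕ × ℕ+ × ℂ => a.2.2)
    rw [h2] at hsub
    have hlen : t.2.length < k := by
      have := (hT t ht).2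
      rw [← List.length_map (fun a : ℕ × ℕ+ × ℂ => a.2.2),
        ← List.length_map (as := legs _) (fun a : ℕ × ℕ+ × ℂ => a.2.2), h2] at this
      simpa [hk] using this
    have := ih _ hlen (FreeMonoid.ofList (t.2.map fun a : ℕ × ℕ+ × ℂ => a.2.2))
      ⟨hZ.1.sublist hsub, fun z hz => hZ.2 z (hsub.subset hz)⟩ (by simp)
    rw [FreeMonoid.toList_ofList, ← h3 _ (hT t ht).1, ← wickVec_zero_legs] at this
    rw [Function.comp, innerSL_apply_apply, inner_smul_right, this, mul_zero]
  rwa [h5, add_zero] at h4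

/-- A contour integral around the other points replaces a field `∂X(z)` in a Wick product by a
derivative of the field at the origin. -/
theorem pureVec_zero_cons_eq {L : List (ℕ+ × ℂ)} {r : ℝ} (hr : 0 < r) (hr1 : r < 1)
    (hL : ∀ p ∈ L, ‖p.2‖ < r) (m : ℕ+) :
    CircleIntegrable (fun z => z ^ (-(m : ℤ)) • pureVec ((1, z) :: L)) 0 r ∧
    (((√2 : ℝ) : ℂ) * Complex.I / (((m : ℕ) - 1)! : ℂ)) • pureVec ((m, 0) :: L) =
      (((√2 : ℝ) : ℂ) / (2 * (Real.pi : ℂ))) •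
        ∮ z in C(0, r), z ^ (-(m : ℤ)) • pureVec ((1, z) :: L) := by
  have h := isMovingField_pure hr hr1 hL
  have hi := h.circleIntegrable (-(m : ℤ))
  refine ⟨hi, lp.ext ?_⟩
  rw [raiseFun_pureVec m fun p hp => (hL p hp).trans hr1]
  funext n
  rw [← modeFun_neg]
  refine (h.modeFun_eq (-(m : ℤ)) (Or.inr (by have := m.pos; omega)) n).symm.trans ?_
  rw [lp.coeFn_smul, Pi.smul_apply, smul_eq_mul]
  exact congrArg _ (circleIntegral_fock_apply hi n).symm

theorem modeConst_ne_zero (m : ℕ+) :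
    ((√2 : ℝ) : ℂ) * Complex.I / (((m : ℕ) - 1)! : ℂ) ≠ 0 := by
  have hf : (((m : ℕ) - 1)! : ℂ) ≠ 0 := by exact_mod_cast Nat.factorial_ne_zero _
  have hs : ((√2 : ℝ) : ℂ) ≠ 0 := by exact_mod_cast (Real.sqrt_ne_zero'.2 two_pos)
  exact div_ne_zero (mul_ne_zero hs Complex.I_ne_zero) hf

theorem inner_pureVec_origin_eq_zero {x : FockSpace}
    (hx : ∀ Z ∈ discSymbols, inner ℂ x (symbolVec (FreeMonoid.map (field 1) Z)) = 0)
    (ms : List ℕ+) : ∀ Z : FreeMonoid ℂ, Z ∈ discSymbols →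
      inner ℂ x (pureVec ((ms.map fun m => (m, 0)) ++ Z.toList.map fun z => (1, z))) = 0 := by
  induction ms with
  | nil => exact fun Z hZ => inner_pureVec_eq_zero hx _ Z hZ rfl
  | cons m ms ih =>
    intro Z hZ
    obtain ⟨r, hr, hr1, hZr⟩ := exists_radius Z.toList fun z hz => (hZ.2 z hz).2
    set L : List (ℕ+ × ℂ) := (ms.map fun m => (m, 0)) ++ Z.toList.map fun z => (1, z) with hL
    have hLr : ∀ p ∈ L, ‖p.2‖ < r := by
      intro p hp
      simp only [hL, List.mem_append, List.mem_map] at hp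
      rcases hp with ⟨m', -, rfl⟩ | ⟨z, hz, rfl⟩
      · simpa using hr
      · exact hZr z hz
    obtain ⟨hi, he⟩ := pureVec_zero_cons_eq hr hr1 hLr m
    have h0 : (∮ z in C(0, r), innerSL ℂ x (z ^ (-(m : ℤ)) • pureVec ((1, z) :: L))) =
        ∮ z in C(0, r), (0 : ℂ) := by
      refine circleIntegral.integral_congr hr.le fun z hz => ?_
      have hzr := mem_sphere_zero_iff_norm.1 hz
      have hz' : FreeMonoid.of z * Z ∈ discSymbols := by
        rw [discSymbols, Set.mem_ofPred_eq, FreeMonoid.toList_mul, FreeMonoid.toList_of,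
          List.singleton_append]
        refine ⟨List.nodup_cons.2 ⟨fun h => (hZr z h).ne hzr, hZ.1⟩, fun w hw => ?_⟩
        rcases List.mem_cons.1 hw with rfl | hw
        · exact ⟨ne_zero_of_mem_sphere hr hz, hzr ▸ hr1⟩
        · exact hZ.2 w hw
      have := ih _ hz'
      rw [FreeMonoid.toList_mul, FreeMonoid.toList_of, List.singleton_append, List.map_cons,
        pureVec_perm List.perm_middle] at this
      simp only [map_smul, innerSL_apply_apply]
      rw [this, smul_zero]
    have h1 := congrArg (innerSL ℂ x) he
    rw [map_smul, map_smul, clm_circleIntegral _ hi, h0] at h1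
    have h2 : (∮ _ in C(0, r), (0 : ℂ)) = 0 := by simp [circleIntegral]
    rw [h2, smul_zero] at h1
    exact (smul_eq_zero.1 h1).resolve_left (modeConst_ne_zero m)

/-- A Wick product of fields at the origin is a multiple of a vector of occupation numbers. -/
theorem exists_pureVec_origin_eq (ms : List ℕ+) : ∃ a : ℂ, a ≠ 0 ∧
    pureVec (ms.map fun m => (m, 0)) =
      a • lp.single 2 (ms.map fun m => Finsupp.single m 1).sum (1 : ℂ) := by
  induction ms with
  | nil => exact ⟨1, one_ne_zero, by rw [one_smul]; exact pureVec_nil⟩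
  | cons m ms ih =>
    obtain ⟨a, ha, h⟩ := ih
    set n₀ := (ms.map fun m => Finsupp.single m 1).sum with hn₀
    refine ⟨modeAmp (m, 0) m.natPred * (((√(n₀ m + 1) : ℝ) : ℂ) * a), ?_, lp.ext ?_⟩
    · have hs : ((√(n₀ m + 1) : ℝ) : ℂ) ≠ 0 := by
        exact_mod_cast (Real.sqrt_ne_zero'.2 (by positivity))
      exact mul_ne_zero (modeAmp_zero_self_ne_zero m) (mul_ne_zero hs ha)
    · funext n
      rw [List.map_cons, pureVec_zero_cons_apply m (by
        intro p hp
        obtain ⟨m', -, rfl⟩ := List.mem_map.1 hp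
        simp), h, List.map_cons, List.sum_cons, ← hn₀, lp.coeFn_smul, lp.coeFn_smul, Pi.smul_apply,
        Pi.smul_apply, lp.single_apply, lp.single_apply, smul_eq_mul, smul_eq_mul, mul_assoc]
      congr 1
      by_cases hn : n = Finsupp.single m 1 + n₀
      · subst hn
        simp [add_comm]
      · rw [Pi.single_eq_of_ne hn]
        by_cases hm : n m = 0
        · simp [hm]
        · have : n - Finsupp.single m 1 ≠ n₀ := by
            intro h'
            exact hn (by rw [← h', add_comm, sub_single_add_single hm])
          rw [Pi.single_eq_of_ne this]
          simp

theorem exists_list_sum_single (n : ℕ+ →₀ ℕ) :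
    ∃ ms : List ℕ+, (ms.map fun m => Finsupp.single m 1).sum = n := by
  induction n using Finsupp.induction_linear with
  | zero => exact ⟨[], rfl⟩
  | add f g hf hg =>
    obtain ⟨l, rfl⟩ := hf
    obtain ⟨l', rfl⟩ := hg
    exact ⟨l ++ l', by simp⟩
  | single m k => exact ⟨List.replicate k m, by simp⟩

theorem eq_zero_of_inner_pureVec_origin {x : FockSpace}
    (hx : ∀ ms : List ℕ+, inner ℂ x (pureVec (ms.map fun m => (m, 0))) = 0) : x = 0 := by
  refine lp.ext (funext fun n => ?_)
  obtain ⟨ms, rfl⟩ := exists_list_sum_single n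
  obtain ⟨a, ha, h⟩ := exists_pureVec_origin_eq ms
  have h1 := hx ms
  rw [h, inner_smul_right, lp.inner_single_right] at h1
  simpa [ha] using h1

/-- The vectors of products of fields at distinct points are total. -/
theorem eq_zero_of_inner_symbolVec {x : FockSpace}
    (hx : ∀ Z ∈ discSymbols, inner ℂ x (symbolVec (FreeMonoid.map (field 1) Z)) = 0) : x = 0 := by
  refine eq_zero_of_inner_pureVec_origin fun ms => ?_
  simpa using inner_pureVec_origin_eq_zero hx ms 1 ⟨by simp, by simp⟩

/-! ### The isomorphism with Fock space -/

/-- The linear map taking products of Wick products to their vectors in Fock space. -/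
def fockMap : WickAlg →ₗ[ℂ] FockSpace :=
  (Finsupp.linearCombination ℂ symbolVec) ∘ₗ (MonoidAlgebra.coeffLinearEquiv ℂ).toLinearMap

theorem fockMap_single (w : FreeMonoid WickSymbol) (a : ℂ) :
    fockMap (MonoidAlgebra.single w a) = a • symbolVec w := by
  simp [fockMap]

theorem toWick_single (Z : FreeMonoid ℂ) (a : ℂ) : toWick (MonoidAlgebra.single Z a) =
    MonoidAlgebra.single (FreeMonoid.map (field 1) Z) a := by
  simp [toWick]

theorem wickExpect_single (w : FreeMonoid WickSymbol) (a : ℂ) :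
    wickExpect (MonoidAlgebra.single w a) = a * pairingSum legWeight (legs w) := by
  simp [wickExpect]
  exact Or.inl rfl

theorem reflect_single (Z : FreeMonoid ℂ) : reflect (MonoidAlgebra.single Z 1) =
    (Z.toList.map fun z => -1 / conj z ^ 2).prod •
      MonoidAlgebra.single (FreeMonoid.map (fun z => 1 / conj z) Z) 1 := by
  simp [reflect]

theorem reflect_zero : reflect 0 = 0 := by simp [reflect]

theorem mem_wickDisc {w : FreeMonoid WickSymbol} (hw : w ∈ wickDiscSymbols) (a : ℂ) :
    MonoidAlgebra.single w a ∈ wickDisc := by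
  classical
  rw [wickDisc, MonoidAlgebra.mem_supported']
  intro v hv
  rw [MonoidAlgebra.coeff_single, Finsupp.single_apply, if_neg]
  rintro rfl
  exact hv hw

theorem inner_fockMap {F : WickAlg} (hF : F ∈ wickDisc) (G : DiscFields) :
    inner ℂ (fockMap (toWick G.incl)) (fockMap F) = wickExpect (toWick (reflect G.incl) * F) := by
  rw [wickDisc, MonoidAlgebra.supported_eq_span_single] at hF
  have hG : G.incl ∈ Submodule.span ℂ
      ((fun m ↦ MonoidAlgebra.single m (1 : ℂ)) '' discSymbols) := by
    rw [← MonoidAlgebra.supported_eq_span_single]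
    exact G.2
  generalize G.incl = G' at hG
  induction hG using Submodule.span_induction with
  | mem G' hG' =>
    obtain ⟨Z, hZ, rfl⟩ := hG'
    induction hF using Submodule.span_induction with
    | mem F hF =>
      obtain ⟨w, hw, rfl⟩ := hF
      rw [toWick_single, fockMap_single, fockMap_single, one_smul, one_smul,
        inner_symbolVec hZ hw.1, reflect_single, map_smul, toWick_single, smul_mul_assoc,
        MonoidAlgebra.single_mul_single, map_smul, wickExpect_single]
      simp
    | zero => simp
    | add F F' _ _ h h' => rw [map_add, inner_add_right, h, h', mul_add, map_add]
    | smul a F _ h => rw [map_smul, inner_smul_right, h, mul_smul_comm, map_smul, smul_eq_mul]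
  | zero => simp [reflect_zero]
  | add G₁ G₂ _ _ h h' =>
    rw [map_add, map_add, inner_add_left, h, h', reflect_add, map_add, add_mul, map_add]
  | smul a G₁ _ h =>
    rw [map_smul, map_smul, inner_smul_left, h, reflect_smul, map_smul, smul_mul_assoc, map_smul,
      smul_eq_mul]

theorem map_field_mem_wickDiscSymbols {Z : FreeMonoid ℂ} (hZ : Z ∈ discSymbols) :
    FreeMonoid.map (field 1) Z ∈ wickDiscSymbols := by
  refine ⟨inDisc_map_field hZ, ?_⟩
  rw [FreeMonoid.toList_map, List.pairwise_map]
  refine hZ.1.imp fun {a b} hab p hp q hq => ?_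
  simp only [field, List.mem_singleton] at hp hq
  subst hp hq
  exact hab

theorem toWick_incl_mem (G : DiscFields) : toWick G.incl ∈ wickDisc := by
  have hG : G.incl ∈ Submodule.span ℂ
      ((fun m ↦ MonoidAlgebra.single m (1 : ℂ)) '' discSymbols) := by
    rw [← MonoidAlgebra.supported_eq_span_single]
    exact G.2
  generalize G.incl = G' at hG
  induction hG using Submodule.span_induction with
  | mem G' hG' =>
    obtain ⟨Z, hZ, rfl⟩ := hG'
    rw [toWick_single]
    exact mem_wickDisc (map_field_mem_wickDiscSymbols hZ) 1
  | zero => simp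
  | add G₁ G₂ _ _ h h' => rw [map_add]; exact add_mem h h'
  | smul a G₁ _ h => rw [map_smul]; exact Submodule.smul_mem _ _ h

/-- The class map as a linear map. -/
def nu0Lin : DiscFields →ₗ[ℂ] ReflHilbert :=
  (UniformSpace.Completion.toComplL (𝕜 := ℂ) (E := SeparationQuotient DiscFields)).toLinearMap ∘ₗ
    (SeparationQuotient.mkCLM ℂ DiscFields).toLinearMap

theorem nu0Lin_apply (G : DiscFields) : nu0Lin G = nu0 G := rfl

/-- The vectors in Fock space of the combinations of products of fields. -/
def discFock : DiscFields →ₗ[ℂ] FockSpace :=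
  fockMap ∘ₗ toWick.toLinearMap ∘ₗ DiscFields.incl

theorem discFock_apply (G : DiscFields) : discFock G = fockMap (toWick G.incl) := rfl

theorem inner_discFock (F G : DiscFields) :
    inner ℂ (discFock F) (discFock G) = inner ℂ (nu0 F) (nu0 G) := by
  rw [inner_nu0, expect_eq_wickExpect, map_mul, discFock_apply, discFock_apply,
    inner_fockMap (toWick_incl_mem G)]

theorem norm_discFock (G : DiscFields) : ‖discFock G‖ = ‖nu0Lin G‖ := by
  rw [← sq_eq_sq₀ (norm_nonneg _) (norm_nonneg _), ← inner_self_eq_norm_sq (𝕜 := ℂ),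
    ← inner_self_eq_norm_sq (𝕜 := ℂ), inner_discFock, nu0Lin_apply]

theorem denseRange_discFock : DenseRange discFock := by
  have h : (LinearMap.range discFock)ᗮ = ⊥ := by
    rw [Submodule.eq_bot_iff]
    intro x hx
    refine eq_zero_of_inner_symbolVec fun Z hZ => ?_
    have hZ' : MonoidAlgebra.single Z (1 : ℂ) ∈ MonoidAlgebra.supported ℂ ℂ discSymbols := by
      rw [MonoidAlgebra.supported_eq_span_single]
      exact Submodule.subset_span ⟨Z, hZ, rfl⟩
    have h1 := Submodule.inner_left_of_mem_orthogonal
      (LinearMap.mem_range_self discFock (⟨_, hZ'⟩ : DiscFields)) hx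
    have h2 : discFock (⟨_, hZ'⟩ : DiscFields) =
        fockMap (toWick (MonoidAlgebra.single Z 1)) := rfl
    rwa [h2, toWick_single, fockMap_single, one_smul] at h1
  rw [← Submodule.topologicalClosure_eq_top_iff] at h
  intro x
  have : x ∈ (LinearMap.range discFock).topologicalClosure := by rw [h]; trivial
  rwa [← SetLike.mem_coe, Submodule.topologicalClosure_coe, LinearMap.coe_range] at this

/-- The unitary from `ℋ` to Fock space. -/
def fockIso : ReflHilbert ≃ₗᵢ[ℂ] FockSpace :=
  (LinearEquiv.refl ℂ DiscFields).extendOfIsometry nu0Lin discFock denseRange_nu0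
    denseRange_discFock norm_discFock

theorem fockIso_nu0 (G : DiscFields) : fockIso (nu0 G) = fockMap (toWick G.incl) :=
  LinearEquiv.extendOfIsometry_eq (LinearEquiv.refl ℂ DiscFields) nu0Lin discFock denseRange_nu0
    denseRange_discFock norm_discFock G

/-! ### The map `ν` -/

theorem inner_fockIso_symm {F : WickAlg} (hF : F ∈ wickDisc) (G : DiscFields) :
    inner ℂ (nu0 G) (fockIso.symm (fockMap F)) = wickExpect (toWick (reflect G.incl) * F) := by
  rw [← inner_fockMap hF, ← fockIso_nu0, ← fockIso.inner_map_map (nu0 G),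
    LinearIsometryEquiv.apply_symm_apply]

theorem fockIso_nuSymbol {w : FreeMonoid WickSymbol} (hw : w ∈ wickDiscSymbols) :
    fockIso (nuSymbol w) = symbolVec w := by
  have h : ∃ v : ReflHilbert, ∀ G : DiscFields, inner ℂ (nu0 G) v =
      wickExpect (toWick (reflect G.incl) * MonoidAlgebra.single w 1) :=
    ⟨_, inner_fockIso_symm (mem_wickDisc hw 1)⟩
  rw [nuSymbol, dif_pos h]
  have h1 : h.choose = fockIso.symm (fockMap (MonoidAlgebra.single w 1)) := by
    refine denseRange_nu0.eq_of_inner_right ℂ fun G => ?_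
    rw [h.choose_spec G, inner_fockIso_symm (mem_wickDisc hw 1)]
  rw [h1, LinearIsometryEquiv.apply_symm_apply, fockMap_single, one_smul]

theorem fockIso_nu {F : WickAlg} (hF : F ∈ wickDisc) : fockIso (nu F) = fockMap F := by
  rw [wickDisc, MonoidAlgebra.supported_eq_span_single] at hF
  induction hF using Submodule.span_induction with
  | mem F hF =>
    obtain ⟨w, hw, rfl⟩ := hF
    rw [fockMap_single, one_smul, ← fockIso_nuSymbol hw]
    simp [nu]
  | zero => simp
  | add F F' _ _ h h' => rw [map_add, map_add, map_add, h, h']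
  | smul a F _ h => rw [map_smul, map_smul, map_smul, h]

theorem of_mem_wickDiscSymbols {Z : WickSymbol} (hZ : ∀ p ∈ Z.1, ‖p.2‖ < 1) :
    FreeMonoid.of Z ∈ wickDiscSymbols := by
  rw [wickDiscSymbols, Set.mem_ofPred_eq, FreeMonoid.toList_of]
  exact ⟨fun S hS => List.mem_singleton.1 hS ▸ hZ, List.pairwise_singleton _ _⟩

theorem fockMap_one : fockMap 1 = pureVec [] := by
  rw [MonoidAlgebra.one_def, fockMap_single, one_smul, symbolVec_one]

/-- By Wick's theorem the unitary takes `𝒟` to the span of the vectors of single Wick products. -/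
theorem mem_domain_iff (v : ReflHilbert) : v ∈ domain ↔ fockIso v ∈ discVectors := by
  constructor
  · rintro ⟨F, hF, rfl⟩
    rw [fockIso_nu hF]
    rw [SetLike.mem_coe, wickDisc, MonoidAlgebra.supported_eq_span_single] at hF
    induction hF using Submodule.span_induction with
    | mem F hF =>
      obtain ⟨w, hw, rfl⟩ := hF
      rw [fockMap_single, one_smul]
      exact symbolVec_mem hw.1
    | zero => simp
    | add F F' _ _ h h' => rw [map_add]; exact add_mem h h'
    | smul a F _ h => rw [map_smul]; exact Submodule.smul_mem _ _ h
  · intro hv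
    have hle : discVectors ≤ wickDisc.map fockMap := by
      refine Submodule.span_le.2 ?_
      rintro _ ⟨L, hL, rfl⟩
      rcases eq_or_ne L [] with rfl | hne
      · exact ⟨1, one_mem_wickDisc, fockMap_one⟩
      · refine ⟨_, mem_wickDisc (of_mem_wickDiscSymbols (Z := ⟨L, hne⟩) hL) 1, ?_⟩
        rw [fockMap_single, one_smul, symbolVec_of]
    obtain ⟨F, hF, h⟩ := hle hv
    have : nu F = v := fockIso.injective (by rw [fockIso_nu hF, h])
    exact this ▸ nu_mem_domain hF

theorem exists_modeOp (j : ℤ) (v : domain) :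
    ∃ u : domain, ⇑(fockIso (u : ReflHilbert)) = modeFun j (fockIso (v : ReflHilbert)) := by
  obtain ⟨u, hu, h⟩ := exists_modeFun_eq j ((mem_domain_iff v).1 v.2)
  refine ⟨⟨fockIso.symm u, (mem_domain_iff _).2 ?_⟩, ?_⟩
  · rwa [LinearIsometryEquiv.apply_symm_apply]
  · rw [← h, LinearIsometryEquiv.apply_symm_apply]

theorem domain_ext {u v : domain}
    (h : ⇑(fockIso (u : ReflHilbert)) = ⇑(fockIso (v : ReflHilbert))) : u = v :=
  Subtype.ext (fockIso.injective (lp.ext h))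

/-- The mode operator `αⱼ` on `𝒟`. -/
def modeOp (j : ℤ) : domain →ₗ[ℂ] domain where
  toFun v := (exists_modeOp j v).choose
  map_add' u v := domain_ext (by
    rw [(exists_modeOp j (u + v)).choose_spec, Submodule.coe_add, Submodule.coe_add, map_add,
      map_add, lp.coeFn_add, lp.coeFn_add, map_add, (exists_modeOp j u).choose_spec,
      (exists_modeOp j v).choose_spec])
  map_smul' a v := domain_ext (by
    rw [(exists_modeOp j (a • v)).choose_spec, RingHom.id_apply, Submodule.coe_smul,
      Submodule.coe_smul, map_smul, map_smul, lp.coeFn_smul, lp.coeFn_smul, map_smul,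
      (exists_modeOp j v).choose_spec])

theorem fockIso_modeOp (j : ℤ) (v : domain) :
    ⇑(fockIso (modeOp j v : ReflHilbert)) = modeFun j (fockIso (v : ReflHilbert)) :=
  (exists_modeOp j v).choose_spec

/-! ### The modes as contour integrals -/

/-- The symbols of products of Wick products in the unit disc with points of modulus less
than `r`. -/
def enclosedSymbols (r : ℝ) : Set (FreeMonoid WickSymbol) :=
  {w | w ∈ wickDiscSymbols ∧ ∀ Z ∈ w.toList, ∀ p ∈ Z.1, ‖p.2‖ < r}

theorem mem_span_enclosed {r : ℝ} {F : WickAlg} (hF : F ∈ wickDisc) (h : Encloses r F) :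
    F ∈ Submodule.span ℂ ((fun w ↦ MonoidAlgebra.single w (1 : ℂ)) '' enclosedSymbols r) := by
  rw [← MonoidAlgebra.supported_eq_span_single, MonoidAlgebra.mem_supported]
  exact fun w hw => ⟨hF hw, h w hw⟩

/-- The field at `z` as an element of the algebra. -/
abbrev fieldAt (z : ℂ) : WickAlg := MonoidAlgebra.single (FreeMonoid.of (field 1 z)) 1

theorem fieldAt_mul_mem {r : ℝ} (hr1 : r < 1) {F : WickAlg} (hF : F ∈ wickDisc)
    (h : Encloses r F) {z : ℂ} (hz : z ∈ Metric.sphere (0 : ℂ) r) : fieldAt z * F ∈ wickDisc := by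
  have hzr := mem_sphere_zero_iff_norm.1 hz
  have hspan := mem_span_enclosed hF h
  clear hF h
  induction hspan using Submodule.span_induction with
  | mem F hF =>
    obtain ⟨w, hw, rfl⟩ := hF
    simp only [fieldAt, MonoidAlgebra.single_mul_single]
    refine mem_wickDisc ⟨fun Z hZ p hp => ?_, ?_⟩ _
    · rw [FreeMonoid.toList_mul, FreeMonoid.toList_of, List.singleton_append, List.mem_cons] at hZ
      rcases hZ with rfl | hZ
      · simp only [field, List.mem_singleton] at hp
        subst hp
        exact hzr ▸ hr1
      · exact hw.1.1 Z hZ p hp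
    · rw [FreeMonoid.toList_mul, FreeMonoid.toList_of, List.singleton_append]
      refine List.Pairwise.cons (fun Z hZ p hp q hq hpq => ?_) hw.1.2
      simp only [field, List.mem_singleton] at hp
      subst hp
      have := hw.2 Z hZ q hq
      rw [← hpq, hzr] at this
      exact this.false
  | zero => simp
  | add F F' _ _ h h' => rw [mul_add]; exact add_mem h h'
  | smul a F _ h => rw [mul_smul_comm]; exact Submodule.smul_mem _ _ h

theorem continuousOn_fock_apply {f : ℂ → FockSpace} {s : Set ℂ} (hf : ContinuousOn f s)
    (n : ℕ+ →₀ ℕ) : ContinuousOn (fun z => f z n) s :=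
  (lp.evalCLM ℂ (fun _ : ℕ+ →₀ ℕ => ℂ) 2 n).continuous.comp_continuousOn hf

/-- The contour integrals of the field, as a statement about coordinates in Fock space. -/
theorem fockMap_fieldAt_mul {r : ℝ} (hr : 0 < r) (hr1 : r < 1) {F : WickAlg}
    (hF : F ∈ wickDisc) (h : Encloses r F) :
    ContinuousOn (fun z => fockMap (fieldAt z * F)) (Metric.sphere 0 r) ∧
    ∀ (j : ℤ) (n : ℕ+ →₀ ℕ), ((√2 : ℝ) : ℂ) / (2 * (Real.pi : ℂ)) *
      (∮ z in C(0, r), z ^ j * fockMap (fieldAt z * F) n) = modeFun j (fockMap F) n := by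
  have hspan := mem_span_enclosed hF h
  clear hF h
  induction hspan using Submodule.span_induction with
  | mem F hF =>
    obtain ⟨w, hw, rfl⟩ := hF
    have hm := isMovingField_symbol hr hr1 hw.2
    have e : ∀ z : ℂ, fockMap (fieldAt z * MonoidAlgebra.single w 1) =
        wickVec legWeight (fun a => modeAmp a.2)
          ((0, 1, z) :: (legs w).map fun a => (1 + a.1, a.2)) := by
      intro z
      rw [fieldAt, MonoidAlgebra.single_mul_single, mul_one, fockMap_single, one_smul,
        symbolVec_field_mul]
    simp only [e, fockMap_single, one_smul]
    refine ⟨hm.continuousOn, fun j n => ?_⟩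
    rw [← wickVec_shift_legs 1 w]
    exact hm.modeFun_eq j (Or.inl rfl) n
  | zero =>
    refine ⟨by simpa using continuousOn_const, fun j n => ?_⟩
    rw [map_zero, lp.coeFn_zero, map_zero]
    simp [circleIntegral]
  | add F F' _ _ h h' =>
    simp only [mul_add, map_add]
    refine ⟨h.1.add h'.1, fun j n => ?_⟩
    have hi : ∀ {f : ℂ → FockSpace}, ContinuousOn f (Metric.sphere 0 r) →
        CircleIntegrable (fun z => z ^ j * f z n) 0 r := fun hf =>
      ((continuousOn_zpow_sphere hr j).mul (continuousOn_fock_apply hf n)).circleIntegrable hr.le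
    simp only [lp.coeFn_add, Pi.add_apply, mul_add, map_add]
    rw [circleIntegral.integral_add (hi h.1) (hi h'.1), mul_add, h.2, h'.2]
  | smul a F _ h =>
    simp only [mul_smul_comm, map_smul]
    refine ⟨h.1.const_smul a, fun j n => ?_⟩
    simp only [lp.coeFn_smul, map_smul, Pi.smul_apply, smul_eq_mul, mul_left_comm _ a,
      circleIntegral.integral_const_mul]
    rw [h.2]

theorem isModeFamily_modeOp : IsModeFamily modeOp := by
  intro j F hF r hr hr1 h
  obtain ⟨hc, hi⟩ := fockMap_fieldAt_mul hr hr1 hF h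
  have hf : ∀ z ∈ Metric.sphere (0 : ℂ) r,
      fockIso (modeIntegrand j F z) = z ^ j • fockMap (fieldAt z * F) := by
    intro z hz
    rw [modeIntegrand, map_smul, fockIso_nu (fieldAt_mul_mem hr1 hF h hz)]
  have hcont : ContinuousOn (fun z => z ^ j • fockMap (fieldAt z * F)) (Metric.sphere 0 r) :=
    (continuousOn_zpow_sphere hr j).smul hc
  have hint : CircleIntegrable (modeIntegrand j F) 0 r := by
    refine ContinuousOn.circleIntegrable hr.le ?_
    refine (fockIso.symm.continuous.comp_continuousOn hcont).congr fun z hz => ?_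
    rw [Function.comp_apply, ← hf z hz, LinearIsometryEquiv.symm_apply_apply]
  refine ⟨hint, fockIso.injective (lp.ext ?_)⟩
  rw [fockIso_modeOp]
  funext n
  have hU : fockIso (∮ z in C(0, r), modeIntegrand j F z) =
      ∮ z in C(0, r), z ^ j • fockMap (fieldAt z * F) := by
    refine (clm_circleIntegral fockIso.toContinuousLinearEquiv.toContinuousLinearMap hint).trans ?_
    exact circleIntegral.integral_congr hr.le hf
  rw [map_smul, hU, lp.coeFn_smul, Pi.smul_apply, smul_eq_mul,
    circleIntegral_fock_apply (hcont.circleIntegrable hr.le), fockIso_nu hF, ← hi]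
  rfl

/-! ### Vectors of occupation numbers -/

theorem fockIso_vacuum : fockIso vacuum = pureVec [] := by
  rw [vacuum, fockIso_nu one_mem_wickDisc, fockMap_one]

theorem norm_origin_lt_one (ms : List ℕ+) :
    ∀ p ∈ ms.map fun m => ((m, 0) : ℕ+ × ℂ), ‖p.2‖ < 1 := by
  intro p hp
  obtain ⟨m, -, rfl⟩ := List.mem_map.1 hp
  simp

theorem fockIso_modeVector (ms : List ℕ+) : fockIso (modeVector modeOp ms : ReflHilbert) =
    (ms.map fun m : ℕ+ => ((√2 : ℝ) : ℂ) * Complex.I / (((m : ℕ) - 1)! : ℂ)).prod •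
      pureVec (ms.map fun m => (m, 0)) := by
  induction ms with
  | nil => rw [List.map_nil, List.prod_nil, one_smul]; exact fockIso_vacuum
  | cons m ms ih =>
    refine lp.ext ?_
    have h : modeVector modeOp (m :: ms) = modeOp (-(m : ℤ)) (modeVector modeOp ms) := rfl
    rw [h, fockIso_modeOp, ih, modeFun_neg, lp.coeFn_smul, map_smul,
      ← raiseFun_pureVec m (norm_origin_lt_one ms), ← lp.coeFn_smul, smul_smul, List.map_cons,
      List.prod_cons, mul_comm]
    rfl

theorem dense_modeVector : Dense (Submodule.span ℂ
    (Set.range fun ms : List ℕ+ => (modeVector modeOp ms : ReflHilbert)) : Set ReflHilbert) := by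
  rw [Submodule.dense_iff_topologicalClosure_eq_top, Submodule.topologicalClosure_eq_top_iff,
    Submodule.eq_bot_iff]
  intro x hx
  have h : fockIso x = 0 := by
    refine eq_zero_of_inner_pureVec_origin fun ms => ?_
    have h1 := Submodule.inner_left_of_mem_orthogonal
      (Submodule.subset_span (Set.mem_range_self ms)) hx
    rw [← fockIso.inner_map_map, fockIso_modeVector, inner_smul_right] at h1
    refine (mul_eq_zero.1 h1).resolve_left (List.prod_ne_zero fun h0 => ?_)
    obtain ⟨m, -, hm⟩ := List.mem_map.1 h0
    exact modeConst_ne_zero m hm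
  simpa using h

theorem separableSpace_reflHilbert : TopologicalSpace.SeparableSpace ReflHilbert := by
  rw [← TopologicalSpace.isSeparable_univ_iff, ← dense_modeVector.closure_eq]
  exact ((Set.countable_range _).isSeparable.span (R := ℂ)).closure

theorem intertwinesModes_fockIso : IntertwinesModes modeOp fockIso := by
  refine ⟨fockIso_vacuum.trans pureVec_nil, fun v m n => ⟨?_, ?_⟩⟩
  · rw [fockIso_modeOp, modeFun_coe]
    rfl
  · rw [fockIso_modeOp, modeFun_neg]
    rfl

end Boson

end

theorem mainTheorem2 :
    (∀ F ∈ wickDisc, ∀ G : DiscFields,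
      inner ℂ (nu0 G) (nu F) = wickExpect (toWick (reflect G.incl) * F)) ∧
    (∀ G : DiscFields, nu (toWick G.incl) = nu0 G) ∧
    ∃ α : ℤ → domain →ₗ[ℂ] domain, IsModeFamily α ∧
      (∀ (ms : List ℕ+) (h : ms ≠ []), (modeVector α ms : ReflHilbert) =
        (ms.map fun m : ℕ+ => ((√2 : ℝ) : ℂ) * Complex.I / (((m : ℕ) - 1)! : ℂ)).prod •
          nu (MonoidAlgebra.single (FreeMonoid.of (wickOrigin ms h)) 1)) ∧
      Dense (Submodule.span ℂ (Set.range fun ms : List ℕ+ => (modeVector α ms : ReflHilbert)) :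
        Set ReflHilbert) ∧
      TopologicalSpace.SeparableSpace ReflHilbert ∧
      ∃ U : ReflHilbert ≃ₗᵢ[ℂ] FockSpace, IntertwinesModes α U := by
  refine ⟨fun F hF G => ?_, fun G => fockIso.injective ?_, modeOp, isModeFamily_modeOp,
    fun ms h => fockIso.injective ?_, dense_modeVector, separableSpace_reflHilbert, fockIso,
    intertwinesModes_fockIso⟩
  · rw [← inner_fockIso_symm hF, ← fockIso_nu hF, LinearIsometryEquiv.symm_apply_apply]
  · rw [fockIso_nu (toWick_incl_mem G), fockIso_nu0]
  · rw [fockIso_modeVector, map_smul, fockIso_nu (mem_wickDisc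
      (of_mem_wickDiscSymbols (Z := wickOrigin ms h) (norm_origin_lt_one ms)) 1), fockMap_single,
      one_smul, symbolVec_of]
    rfl
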